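/- Let $\mathbb{D}$ be the open unit disk in $\mathbb{C}$, and let $H^2$ be the Hardy space of all analytic functions $f$ on $\mathbb{D}$ such that $$\|f\|^2=\lim_{r\to1^-}\frac1{2\pi}\int_0^{2\pi}|f(re^{i\theta})|^2\,d\theta<\infty .$$ Let $\varphi:\mathbb{D}\to\mathbb{D}$ be analytic and let $n$ be a positive integer. For $f\in H^2$ put $D_{\varphi,n}f=f^{(n)}\circ\varphi$. The Nevanlinna counting function of $\varphi$ is $$N_\varphi(w)=\sum_{z\in\mathbb{D},\ \varphi(z)=w}\log\frac1{|z|}\in[0,\infty]\quad (w\in\mathbb{D}\setminus\{\varphi(0)\}),\qquad N_\varphi(\varphi(0))=\infty,$$ where the preimages $z$ are counted with multiplicity. Then $D_{\varphi,n}$ is a bounded operator on $H^2$ (that is, $D_{\varphi,n}f\in H^2$ for every $f\in H^2$, and there is a constant $C$ with $\|D_{\varphi,n}f\|\le C\|f\|$ for all $f\in H^2$) if and only if $$N_\varphi(w)=O\Big(\big[\log(1/|w|)\big]^{2n+1}\Big)\qquad(|w|\to1^-),$$ that is, there are constants $M\ge 0$ and $R\in(0,1)$ such that $N_\varphi(w)\le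 M[\log(1/|w|)]^{2n+1}$ whenever $R<|w|<1$. -/

import Mathlib

open Filter Topology Metric
open scoped ENNReal NNReal

noncomputable section

/-- `φ` is an analytic self-map of the open unit disk `ball 0 1`. As everywhere below, functions on
the disk are represented by functions `ℂ → ℂ` whose values outside the disk are irrelevant. -/
def IsAnalyticSelfMap (φ : ℂ → ℂ) : Prop :=
  AnalyticOnNhd ℂ φ (ball 0 1) ∧ Set.MapsTo φ (ball 0 1) (ball 0 1)

/-- The integral mean `(1 / 2π) ∫_0^{2π} |f(r e^{iθ})|² dθ`. -/
def sqMean (f : ℂ → ℂ) (r : ℝ) : ℝ :=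
  Real.circleAverage (fun z => ‖f z‖ ^ 2) 0 r

/-- Membership in the Hardy space `H²` of the disk: `f` is analytic on the disk and its square means
have a finite limit as `r → 1⁻`. -/
def MemHardyTwo (f : ℂ → ℂ) : Prop :=
  AnalyticOnNhd ℂ f (ball 0 1) ∧ ∃ L : ℝ, Tendsto (sqMean f) (𝓝[<] 1) (𝓝 L)

/-- The norm of `H²`; meaningful for `f` satisfying `MemHardyTwo f`. -/
def hardyTwoNorm (f : ℂ → ℂ) : ℝ :=
  Real.sqrt (limUnder (𝓝[<] (1 : ℝ)) (sqMean f))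

/-- The operator `D_{φ,n} f = f^{(n)} ∘ φ`. -/
def compDiff (φ : ℂ → ℂ) (n : ℕ) (f : ℂ → ℂ) : ℂ → ℂ :=
  fun z => iteratedDeriv n f (φ z)

/-- `T` is a bounded operator on `H²`: it maps `H²` into itself and `‖T f‖ ≤ C ‖f‖` for all
`f ∈ H²`, with a constant `C` independent of `f`. -/
def IsBoundedOnHardyTwo (T : (ℂ → ℂ) → ℂ → ℂ) : Prop :=
  (∀ f, MemHardyTwo f → MemHardyTwo (T f)) ∧
    ∃ C : ℝ, ∀ f, MemHardyTwo f → hardyTwoNorm (T f) ≤ C * hardyTwoNorm f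

/-- The Nevanlinna counting function `N_φ(w) = ∑_{φ(z) = w} log (1 / |z|)`, each preimage `z` in the
disk counted with multiplicity (the order of vanishing of `φ - w` at `z`), with `N_φ(φ(0)) = ∞`. -/
def nevanlinnaCounting (φ : ℂ → ℂ) (w : ℂ) : ℝ≥0∞ :=
  open scoped Classical in
  if w = φ 0 then ∞
  else ∑' z : {z : ℂ // z ∈ ball (0 : ℂ) 1 ∧ φ z = w},
    ((analyticOrderAt (fun u => φ u - w) (z : ℂ) : ℕ∞) : ℝ≥0∞) *
      ENNReal.ofReal (Real.log (1 / ‖(z : ℂ)‖))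

/-- `N_φ(w) = O([log (1 / |w|)]^k)` as `|w| → 1`, `w` in the disk. The estimate is stated in
`[0, ∞]`, so it includes finiteness of `N_φ(w)` for `|w|` close to `1`. -/
def CountingBigO (φ : ℂ → ℂ) (k : ℕ) : Prop :=
  ∃ C : ℝ≥0, ∀ᶠ w : ℂ in comap (fun w : ℂ => ‖w‖) (𝓝[<] (1 : ℝ)),
    nevanlinnaCounting φ w ≤ C * ENNReal.ofReal (Real.log (1 / ‖w‖) ^ k)

end

open scoped ComplexConjugate

noncomputable section

/-! The bridge between `H²` and counting functions is the Littlewood–Paley identity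
(`lintegral_littlewoodPaley`): `‖g‖² - |g(0)|²` equals `(2/π) ∫ |g'|² log(1/|z|)` over the disk. It
is applied to `g = f⁽ⁿ⁾ ∘ φ`, whose derivative is `(f⁽ⁿ⁺¹⁾ ∘ φ) φ'`.

Sufficiency. Where `|φ| > R`, the change of variables `w = φ(z)` bounds the integral by `∫ |f⁽ⁿ⁺¹⁾|²
N_φ`, hence by a multiple of `∫ |f⁽ⁿ⁺¹⁾|² log(1/|w|)^(2n+1)`. Computed in Taylor coefficients, this
is at most a constant times `‖f‖²`: the weight costs exactly the `2n+2` powers of the index gained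
by differentiating. Where `|φ| ≤ R`, `f⁽ⁿ⁺¹⁾` is pointwise at most a constant times `‖f‖`, and
Littlewood–Paley for `φ` itself finishes.

Necessity. The test function is the Szegő kernel `k_w`, with `‖k_w‖² = 1/A`, `A = 1 - |w|²`. Let `F`
be `φ` followed by the disk automorphism sending `w` to `0`, so that `N_φ(w)` sums `log(1/|z|)` over
the zeros of `F`. By Jensen this sum is at most the limiting mean of `log|F|` minus `log|F(0)|`. Now
`log|F|` is majorized by `P(|F|²) - P(1)` for a polynomial `P` (`logPoly`) with `(tP')' =
(p+1)(1-t)^p/2`. The means of `P(|F|²)` are combinations of the norms of the powers of `F`, so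
Littlewood–Paley turns them into the integral of `(1-|F|²)^p |F'|² log(1/|z|)`. For `p = 2n` that
density is at most a multiple of `A^(2n+2) |(k_w⁽ⁿ⁾ ∘ φ)'|²` (`diskMoebius_kernel_bound`), so
boundedness gives `A^(2n+2) · A⁻¹`. The error made at the origin is only `(1-|F(0)|²)^(2n+2)`, which
is also `O(A^(2n+1))`. -/

/-! ### Taylor coefficients, Parseval on circles, and `H²` as a sequence space. -/

/-- The `j`-th Taylor coefficient at the origin. -/
def taylorCoeff (f : ℂ → ℂ) (j : ℕ) : ℂ := (j.factorial : ℂ)⁻¹ * iteratedDeriv j f 0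

theorem hasSum_taylorCoeff {f : ℂ → ℂ} (hf : AnalyticOnNhd ℂ f (ball 0 1)) {z : ℂ}
    (hz : z ∈ ball (0 : ℂ) 1) : HasSum (fun j => taylorCoeff f j * z ^ j) (f z) := by
  have h := Complex.hasSum_taylorSeries_on_ball (c := 0) (r := 1)
    (f := f) hf.differentiableOn hz
  refine h.congr_fun ?_
  intro j
  simp [taylorCoeff]
  ring

theorem summable_norm_taylorCoeff {f : ℂ → ℂ} (hf : AnalyticOnNhd ℂ f (ball 0 1)) {r : ℝ}
    (h0 : 0 ≤ r) (h1 : r < 1) : Summable (fun j => ‖taylorCoeff f j‖ * r ^ j) := by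
  have hz : (r : ℂ) ∈ ball (0 : ℂ) 1 := by simpa [abs_of_nonneg h0] using h1
  have h := (hasSum_taylorCoeff hf hz).summable.norm
  simpa [abs_of_nonneg h0] using h

theorem integral_exp_int_mul (m : ℤ) :
    ∫ θ in (0 : ℝ)..2 * Real.pi, Complex.exp (m * Complex.I * θ) =
      if m = 0 then 2 * (Real.pi : ℂ) else 0 := by
  split_ifs with h
  · simp [h]
  · rw [integral_exp_mul_complex (by simpa using h)]
    have : (m : ℂ) * Complex.I * ((2 * Real.pi : ℝ) : ℂ) = m * (2 * Real.pi * Complex.I) := by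
      push_cast; ring
    rw [this, Complex.exp_int_mul_two_pi_mul_I]
    simp

theorem continuous_comp_circleMap {f : ℂ → ℂ} (hf : AnalyticOnNhd ℂ f (ball 0 1)) {r : ℝ}
    (h0 : 0 ≤ r) (h1 : r < 1) : Continuous (fun θ : ℝ => f (circleMap 0 r θ)) := by
  refine hf.continuousOn.comp_continuous (continuous_circleMap 0 r) fun θ => ?_
  simpa [circleMap, abs_of_nonneg h0] using h1

/-- The power series converges absolutely on the circle, so it may be integrated term by term
against a character; orthogonality leaves at most one term. -/
theorem fourierCoeffOn_circleMap {f : ℂ → ℂ} (hf : AnalyticOnNhd ℂ f (ball 0 1)) {r : ℝ}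
    (h0 : 0 ≤ r) (h1 : r < 1) (n : ℤ) :
    fourierCoeffOn Real.two_pi_pos (fun θ : ℝ => f (circleMap 0 r θ)) n =
      if 0 ≤ n then taylorCoeff f n.toNat * r ^ n.toNat else 0 := by
  rw [fourierCoeffOn_eq_integral]
  have hpt (θ : ℝ) : HasSum (fun j : ℕ => taylorCoeff f j * r ^ j *
      Complex.exp (((j - n : ℤ) : ℂ) * Complex.I * θ))
      (fourier (-n) (θ : AddCircle (2 * Real.pi - 0)) • f (circleMap 0 r θ)) := by
    have hz : circleMap 0 r θ ∈ ball (0 : ℂ) 1 := by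
      simpa [circleMap, abs_of_nonneg h0] using h1
    refine ((hasSum_taylorCoeff hf hz).mul_left
      (fourier (-n) (θ : AddCircle (2 * Real.pi - 0)))).congr_fun fun j => ?_
    rw [fourier_coe_apply, circleMap]
    have he : Complex.exp (((j - n : ℤ) : ℂ) * Complex.I * θ) =
        Complex.exp (2 * Real.pi * Complex.I * ((-n : ℤ) : ℂ) * θ / ((2 * Real.pi - 0 : ℝ) : ℂ)) *
          Complex.exp (j * (θ * Complex.I)) := by
      rw [← Complex.exp_add]
      congr 1
      have : (Real.pi : ℂ) ≠ 0 := by exact_mod_cast Real.pi_ne_zero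
      push_cast
      field_simp
      ring
    rw [he, zero_add, mul_pow, ← Complex.exp_nat_mul]
    ring
  have hint := intervalIntegral.hasSum_integral_of_dominated_convergence (a := 0)
    (b := 2 * Real.pi) (μ := MeasureTheory.volume)
    (F := fun (j : ℕ) (θ : ℝ) => taylorCoeff f j * r ^ j *
      Complex.exp (((j - n : ℤ) : ℂ) * Complex.I * θ))
    (f := fun θ : ℝ => fourier (-n) (θ : AddCircle (2 * Real.pi - 0)) • f (circleMap 0 r θ))
    (fun j _ => ‖taylorCoeff f j‖ * r ^ j)
    (fun j => by
      apply Continuous.aestronglyMeasurable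
      fun_prop)
    (fun j => by
      refine .of_forall fun θ _ => ?_
      have : ‖Complex.exp (((j - n : ℤ) : ℂ) * Complex.I * θ)‖ = 1 := by
        rw [Complex.norm_exp]; simp
      rw [norm_mul, this]
      simp [abs_of_nonneg h0])
    (.of_forall fun θ _ => summable_norm_taylorCoeff hf h0 h1)
    (by simp)
    (.of_forall fun θ _ => hpt θ)
  have hterm (j : ℕ) : ∫ θ in (0 : ℝ)..2 * Real.pi, taylorCoeff f j * r ^ j *
      Complex.exp (((j - n : ℤ) : ℂ) * Complex.I * θ) =
      if (j : ℤ) = n then 2 * (Real.pi : ℂ) * (taylorCoeff f j * r ^ j) else 0 := by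
    rw [intervalIntegral.integral_const_mul, integral_exp_int_mul]
    split_ifs with h1 h2 h2
    · ring
    · omega
    · omega
    · simp
  simp only [hterm] at hint
  have hpi : (2 * Real.pi : ℂ) ≠ 0 := by
    exact_mod_cast Real.two_pi_pos.ne'
  split_ifs with hn
  · obtain ⟨k, rfl⟩ := Int.eq_ofNat_of_zero_le hn
    have h2 := hasSum_ite_eq k (2 * (Real.pi : ℂ) * (taylorCoeff f k * r ^ k))
    have h3 := hint.unique (h2.congr_fun fun j => by
      by_cases h : j = k <;> simp [h])
    rw [h3]
    simp only [sub_zero, Int.toNat_natCast, Complex.real_smul]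
    push_cast
    field_simp
  · have h3 := hint.unique ((hasSum_zero).congr_fun fun j => by
      rw [if_neg (by omega)])
    rw [h3]; simp

theorem hasSum_sqMean {f : ℂ → ℂ} (hf : AnalyticOnNhd ℂ f (ball 0 1)) {r : ℝ}
    (h0 : 0 ≤ r) (h1 : r < 1) :
    HasSum (fun j => ‖taylorCoeff f j‖ ^ 2 * (r ^ 2) ^ j) (sqMean f r) := by
  have hc := continuous_comp_circleMap hf h0 h1
  have hL2 : MeasureTheory.MemLp (fun θ : ℝ => f (circleMap 0 r θ)) 2
      (MeasureTheory.volume.restrict (Set.Ioc 0 (2 * Real.pi))) := by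
    refine (MeasureTheory.memLp_two_iff_integrable_sq_norm hc.aestronglyMeasurable).2 ?_
    exact ((hc.norm.pow 2).integrableOn_Icc (a := 0) (b := 2 * Real.pi)).mono_set
      Set.Ioc_subset_Icc_self
  have h := hasSum_sq_fourierCoeffOn Real.two_pi_pos hL2
  simp only [fourierCoeffOn_circleMap hf h0 h1, sub_zero] at h
  have h2 : sqMean f r = (2 * Real.pi)⁻¹ • ∫ θ in (0 : ℝ)..2 * Real.pi,
      ‖f (circleMap 0 r θ)‖ ^ 2 := rfl
  rw [h2]
  have hinj : Function.Injective (fun j : ℕ => (j : ℤ)) := Nat.cast_injective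
  rw [← hinj.hasSum_iff] at h
  · refine h.congr_fun fun j => ?_
    simp [abs_of_nonneg h0, mul_pow, ← pow_mul, mul_comm]
  · intro i hi
    rw [if_neg]
    · simp
    · intro h
      exact hi ⟨i.toNat, by simp [h]⟩

theorem sum_norm_taylorCoeff_sq_le {f : ℂ → ℂ} (hf : AnalyticOnNhd ℂ f (ball 0 1)) {L : ℝ}
    (hL : Tendsto (sqMean f) (𝓝[<] 1) (𝓝 L)) (s : Finset ℕ) :
    ∑ j ∈ s, ‖taylorCoeff f j‖ ^ 2 ≤ L := by
  have h1 : Tendsto (fun r : ℝ => ∑ j ∈ s, ‖taylorCoeff f j‖ ^ 2 * (r ^ 2) ^ j) (𝓝[<] 1)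
      (𝓝 (∑ j ∈ s, ‖taylorCoeff f j‖ ^ 2)) := by
    have : Continuous (fun r : ℝ => ∑ j ∈ s, ‖taylorCoeff f j‖ ^ 2 * (r ^ 2) ^ j) := by fun_prop
    simpa using (this.tendsto 1).mono_left nhdsWithin_le_nhds
  refine le_of_tendsto_of_tendsto h1 hL ?_
  filter_upwards [Ioo_mem_nhdsLT (show (0 : ℝ) < 1 by norm_num)] with r hr
  exact sum_le_hasSum _ (fun j _ => by positivity) (hasSum_sqMean hf hr.1.le hr.2)

theorem tendsto_sqMean {f : ℂ → ℂ} (hf : AnalyticOnNhd ℂ f (ball 0 1))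
    (hs : Summable fun j => ‖taylorCoeff f j‖ ^ 2) :
    Tendsto (sqMean f) (𝓝[<] 1) (𝓝 (∑' j, ‖taylorCoeff f j‖ ^ 2)) := by
  have h := tendsto_tsum_of_dominated_convergence (𝓕 := 𝓝[<] (1 : ℝ))
    (f := fun r j => ‖taylorCoeff f j‖ ^ 2 * (r ^ 2) ^ j) (g := fun j => ‖taylorCoeff f j‖ ^ 2)
    hs (fun j => by
      have : Continuous (fun r : ℝ => ‖taylorCoeff f j‖ ^ 2 * (r ^ 2) ^ j) := by fun_prop
      simpa using (this.tendsto 1).mono_left nhdsWithin_le_nhds) (by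
      filter_upwards [Ioo_mem_nhdsLT (show (0 : ℝ) < 1 by norm_num)] with r hr j
      rw [Real.norm_of_nonneg (by positivity)]
      refine mul_le_of_le_one_right (by positivity) (pow_le_one₀ (by positivity) ?_)
      exact pow_le_one₀ hr.1.le hr.2.le)
  refine h.congr' ?_
  filter_upwards [Ioo_mem_nhdsLT (show (0 : ℝ) < 1 by norm_num)] with r hr
  exact (hasSum_sqMean hf hr.1.le hr.2).tsum_eq

/-- By Parseval the square mean at radius `r` is a power series in `r²` with nonnegative
coefficients. Its limit at `1` bounds every partial sum of the coefficients, and conversely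
dominated convergence supplies the limit. -/
theorem memHardyTwo_iff {f : ℂ → ℂ} :
    MemHardyTwo f ↔
      AnalyticOnNhd ℂ f (ball 0 1) ∧ Summable fun j => ‖taylorCoeff f j‖ ^ 2 := by
  constructor
  · rintro ⟨hf, L, hL⟩
    exact ⟨hf, summable_of_sum_le (fun j => by positivity) (sum_norm_taylorCoeff_sq_le hf hL)⟩
  · rintro ⟨hf, hs⟩
    exact ⟨hf, _, tendsto_sqMean hf hs⟩

theorem MemHardyTwo.summable {f : ℂ → ℂ} (hf : MemHardyTwo f) :
    Summable fun j => ‖taylorCoeff f j‖ ^ 2 := (memHardyTwo_iff.1 hf).2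

theorem MemHardyTwo.tendsto_sqMean {f : ℂ → ℂ} (hf : MemHardyTwo f) :
    Tendsto (sqMean f) (𝓝[<] 1) (𝓝 (∑' j, ‖taylorCoeff f j‖ ^ 2)) :=
  _root_.tendsto_sqMean hf.1 hf.summable

theorem MemHardyTwo.hardyTwoNorm_sq {f : ℂ → ℂ} (hf : MemHardyTwo f) :
    hardyTwoNorm f ^ 2 = ∑' j, ‖taylorCoeff f j‖ ^ 2 := by
  rw [hardyTwoNorm, hf.tendsto_sqMean.limUnder_eq, Real.sq_sqrt]
  exact tsum_nonneg fun j => by positivity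

theorem hardyTwoNorm_nonneg (f : ℂ → ℂ) : 0 ≤ hardyTwoNorm f := Real.sqrt_nonneg _

theorem memHardyTwo_of_bounded {f : ℂ → ℂ} (hf : AnalyticOnNhd ℂ f (ball 0 1)) {M : ℝ}
    (hM : ∀ z ∈ ball (0 : ℂ) 1, ‖f z‖ ≤ M) : MemHardyTwo f := by
  refine memHardyTwo_iff.2 ⟨hf, summable_of_sum_le (c := M ^ 2) (fun j => by positivity) ?_⟩
  intro s
  have h1 : Tendsto (fun r : ℝ => ∑ j ∈ s, ‖taylorCoeff f j‖ ^ 2 * (r ^ 2) ^ j) (𝓝[<] 1)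
      (𝓝 (∑ j ∈ s, ‖taylorCoeff f j‖ ^ 2)) := by
    have : Continuous (fun r : ℝ => ∑ j ∈ s, ‖taylorCoeff f j‖ ^ 2 * (r ^ 2) ^ j) := by fun_prop
    simpa using (this.tendsto 1).mono_left nhdsWithin_le_nhds
  refine le_of_tendsto h1 ?_
  filter_upwards [Ioo_mem_nhdsLT (show (0 : ℝ) < 1 by norm_num)] with r hr
  refine (sum_le_hasSum _ (fun j _ => by positivity) (hasSum_sqMean hf hr.1.le hr.2)).trans ?_
  refine Real.circleAverage_mono_on_of_le_circle ?_ ?_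
  · exact (((continuous_comp_circleMap hf hr.1.le hr.2).norm.pow 2).intervalIntegrable _ _)
  · intro z hz
    have hz' : z ∈ ball (0 : ℂ) 1 := by
      have : ‖z‖ = r := by simpa [abs_of_pos hr.1] using hz
      simpa [this] using hr.2
    gcongr
    exact hM z hz'

/-! ### Radial area integrals and the Littlewood–Paley identity. -/

/-- The substitution `s = e⁻ˣ` turns this into the Gamma integral of `x^q e^(-(p+1)x)`. -/
theorem lintegral_log_pow (p q : ℕ) :
    ∫⁻ s in Set.Ioo (0 : ℝ) 1, ENNReal.ofReal (s ^ p * Real.log (1 / s) ^ q) =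
      ENNReal.ofReal (q.factorial / ((p : ℝ) + 1) ^ (q + 1)) := by
  have himg : Set.Ioo (0 : ℝ) 1 = (fun x => Real.exp (-x)) '' Set.Ioi 0 := by
    ext s
    constructor
    · rintro ⟨h0, h1⟩
      exact ⟨-Real.log s, by simpa using Real.log_neg h0 h1, by simp [Real.exp_log h0]⟩
    · rintro ⟨x, hx, rfl⟩
      exact ⟨Real.exp_pos _, by simpa using hx⟩
  rw [himg, MeasureTheory.lintegral_image_eq_lintegral_abs_deriv_mul
    (f' := fun x => -Real.exp (-x)) measurableSet_Ioi
    (fun x _ => by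
      have := ((hasDerivAt_neg x).exp).hasDerivWithinAt (s := Set.Ioi 0)
      simpa using this)
    (fun x _ y _ h => by simpa using h)]
  have hp : (0 : ℝ) < p + 1 := by positivity
  have hpt : ∀ x ∈ Set.Ioi (0 : ℝ), ENNReal.ofReal |-Real.exp (-x)| *
      ENNReal.ofReal (Real.exp (-x) ^ p * Real.log (1 / Real.exp (-x)) ^ q) =
      ENNReal.ofReal (x ^ ((q + 1 : ℝ) - 1) * Real.exp (-((p + 1) * x))) := by
    intro x hx
    rw [← ENNReal.ofReal_mul (abs_nonneg _)]
    congr 1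
    rw [abs_neg, abs_of_pos (Real.exp_pos _), one_div, ← Real.exp_neg, Real.log_exp, neg_neg,
      add_sub_cancel_right, Real.rpow_natCast, ← Real.exp_nat_mul, ← mul_assoc, ← Real.exp_add,
      mul_comm]
    ring_nf
  rw [MeasureTheory.setLIntegral_congr_fun measurableSet_Ioi hpt]
  have key := Real.integral_rpow_mul_exp_neg_mul_Ioi (a := q + 1) (by positivity) hp
  rw [← MeasureTheory.ofReal_integral_eq_lintegral_ofReal, key]
  · congr 1
    rw [Real.Gamma_nat_eq_factorial, ← Nat.cast_succ q, Real.rpow_natCast, Nat.succ_eq_add_one, one_div,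
      inv_pow]
    field_simp
  · refine MeasureTheory.Integrable.of_integral_ne_zero ?_
    rw [key]
    have := Real.Gamma_pos_of_pos (s := (q : ℝ) + 1) (by positivity)
    positivity
  · refine (MeasureTheory.ae_restrict_iff' measurableSet_Ioi).2 (.of_forall fun x hx => ?_)
    have : (0 : ℝ) < x := hx
    positivity

theorem lintegral_circle_sq {f : ℂ → ℂ} (hf : AnalyticOnNhd ℂ f (ball 0 1)) {r : ℝ}
    (h0 : 0 ≤ r) (h1 : r < 1) :
    ∫⁻ θ in Set.Ioo (-Real.pi) Real.pi, ENNReal.ofReal (‖f (circleMap 0 r θ)‖ ^ 2) =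
      ENNReal.ofReal (2 * Real.pi) *
        ∑' j, ENNReal.ofReal (‖taylorCoeff f j‖ ^ 2) * ENNReal.ofReal (r ^ (2 * j)) := by
  have hc : Continuous fun θ : ℝ => ‖f (circleMap 0 r θ)‖ ^ 2 :=
    (continuous_comp_circleMap hf h0 h1).norm.pow 2
  have hpi : -Real.pi ≤ Real.pi := by linarith [Real.pi_pos]
  have h2 : ∫ θ in Set.Ioo (-Real.pi) Real.pi, ‖f (circleMap 0 r θ)‖ ^ 2 =
      2 * Real.pi * sqMean f r := by
    rw [sqMean, Real.circleAverage_eq_integral_add (-Real.pi),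
      intervalIntegral.integral_comp_add_right (fun θ => ‖f (circleMap 0 r θ)‖ ^ 2),
      ← MeasureTheory.integral_Ioc_eq_integral_Ioo, ← intervalIntegral.integral_of_le hpi]
    have : Real.pi ≠ 0 := Real.pi_ne_zero
    simp only [smul_eq_mul]
    field_simp
    congr 1 <;> ring
  rw [← MeasureTheory.ofReal_integral_eq_lintegral_ofReal, h2,
    ENNReal.ofReal_mul (by positivity), ← (hasSum_sqMean hf h0 h1).tsum_eq,
    ENNReal.ofReal_tsum_of_nonneg (fun j => by positivity) (hasSum_sqMean hf h0 h1).summable]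
  · congr 2
    ext j
    rw [ENNReal.ofReal_mul (by positivity), pow_mul]
  · exact (hc.integrableOn_Icc).mono_set Set.Ioo_subset_Icc_self
  · exact .of_forall fun θ => by positivity

/-- Polar coordinates and Parseval on each circle; the Jacobian accounts for the odd exponent `2j +
1`. -/
theorem lintegral_ball_radial {f : ℂ → ℂ} (hf : AnalyticOnNhd ℂ f (ball 0 1))
    {w : ℝ → ℝ≥0∞} (hw : Measurable w) :
    ∫⁻ z in ball (0 : ℂ) 1, ENNReal.ofReal (‖f z‖ ^ 2) * w ‖z‖ =
      ENNReal.ofReal (2 * Real.pi) * ∑' j, ENNReal.ofReal (‖taylorCoeff f j‖ ^ 2) *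
        ∫⁻ s in Set.Ioo (0 : ℝ) 1, ENNReal.ofReal (s ^ (2 * j + 1)) * w s := by
  classical
  -- `f` is arbitrary off the disk; extending by zero makes it measurable on the whole plane.
  set g : ℂ → ℂ := (ball (0 : ℂ) 1).piecewise f 0 with hg
  have hgm : Measurable g :=
    hf.continuousOn.measurable_piecewise continuousOn_const measurableSet_ball
  set G : ℂ → ℝ≥0∞ := fun z => ENNReal.ofReal (‖g z‖ ^ 2) * w ‖z‖ with hG
  have hGm : Measurable G := by fun_prop
  have h1 : ∫⁻ z in ball (0 : ℂ) 1, ENNReal.ofReal (‖f z‖ ^ 2) * w ‖z‖ = ∫⁻ z, G z := by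
    rw [← MeasureTheory.lintegral_indicator measurableSet_ball]
    congr 1
    ext z
    by_cases hz : z ∈ ball (0 : ℂ) 1
    · rw [Set.indicator_of_mem hz, hG]
      simp only [hg, Set.piecewise_eq_of_mem _ _ _ hz]
    · rw [Set.indicator_of_notMem hz, hG]
      have : g z = 0 := Set.piecewise_eq_of_notMem _ _ _ hz
      simp [this]
  have hcm (r θ : ℝ) : Complex.polarCoord.symm (r, θ) = circleMap 0 r θ := by
    rw [Complex.polarCoord_symm_apply, circleMap, Complex.exp_mul_I]
    simp
  rw [h1, ← Complex.lintegral_comp_polarCoord_symm, polarCoord_target,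
    MeasureTheory.Measure.volume_eq_prod, ← MeasureTheory.Measure.prod_restrict,
    MeasureTheory.lintegral_prod]
  swap
  · have : Measurable fun p : ℝ × ℝ => Complex.polarCoord.symm p := by
      have : (fun p : ℝ × ℝ => Complex.polarCoord.symm p) = fun p => circleMap 0 p.1 p.2 := by
        ext p
        exact hcm p.1 p.2
      rw [this]
      unfold circleMap
      fun_prop
    simp only [smul_eq_mul]
    fun_prop
  simp only [hcm, smul_eq_mul]
  have h2 : ∀ r ∈ Set.Ioi (0 : ℝ), ∫⁻ θ in Set.Ioo (-Real.pi) Real.pi,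
      ENNReal.ofReal r * G (circleMap 0 r θ) =
      (Set.Ioo (0 : ℝ) 1).indicator (fun s => ENNReal.ofReal (2 * Real.pi) *
        ∑' j, ENNReal.ofReal (‖taylorCoeff f j‖ ^ 2) *
          (ENNReal.ofReal (s ^ (2 * j + 1)) * w s)) r := by
    intro r (hr : 0 < r)
    have hn (θ : ℝ) : ‖circleMap 0 r θ‖ = r := by simp [circleMap, abs_of_pos hr]
    by_cases h : r < 1
    · rw [Set.indicator_of_mem (show r ∈ Set.Ioo (0 : ℝ) 1 from ⟨hr, h⟩)]
      have (θ : ℝ) : ENNReal.ofReal r * G (circleMap 0 r θ) =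
          (ENNReal.ofReal r * w r) * ENNReal.ofReal (‖f (circleMap 0 r θ)‖ ^ 2) := by
        have : circleMap 0 r θ ∈ ball (0 : ℂ) 1 := by rw [mem_ball_zero_iff, hn]; exact h
        simp only [hG, hg, Set.piecewise_eq_of_mem _ _ _ this, hn]
        ring
      simp only [this]
      rw [MeasureTheory.lintegral_const_mul, lintegral_circle_sq hf hr.le h, mul_left_comm,
        ← ENNReal.tsum_mul_left]
      · congr 2
        ext j
        rw [pow_succ r, ENNReal.ofReal_mul (by positivity)]
        ring
      · exact ((continuous_comp_circleMap hf hr.le h).norm.pow 2).measurable.ennreal_ofReal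
    · rw [Set.indicator_of_notMem (fun h' => h h'.2)]
      have (θ : ℝ) : G (circleMap 0 r θ) = 0 := by
        have h' : circleMap 0 r θ ∉ ball (0 : ℂ) 1 := by rw [mem_ball_zero_iff, hn]; exact h
        have : g (circleMap 0 r θ) = 0 := Set.piecewise_eq_of_notMem _ _ _ h'
        simp [hG, this]
      simp [this]
  rw [MeasureTheory.setLIntegral_congr_fun measurableSet_Ioi h2,
    MeasureTheory.lintegral_indicator measurableSet_Ioo,
    MeasureTheory.Measure.restrict_restrict measurableSet_Ioo,
    Set.inter_eq_self_of_subset_left Set.Ioo_subset_Ioi_self,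
    MeasureTheory.lintegral_const_mul _ (by fun_prop), MeasureTheory.lintegral_tsum (by fun_prop)]
  congr 2
  ext j
  rw [MeasureTheory.lintegral_const_mul _ (by fun_prop)]

theorem taylorCoeff_deriv (f : ℂ → ℂ) (j : ℕ) :
    taylorCoeff (deriv f) j = (j + 1) * taylorCoeff f (j + 1) := by
  rw [taylorCoeff, taylorCoeff, iteratedDeriv_succ', Nat.factorial_succ]
  have : (j.factorial : ℂ) ≠ 0 := by exact_mod_cast j.factorial_ne_zero
  have : ((j : ℂ) + 1) ≠ 0 := by exact_mod_cast j.succ_ne_zero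
  push_cast
  field_simp

/-- The logarithmic moment `1/(2j+2)²` cancels the factor `(j+1)²` from differentiation, leaving
`2π/4`. -/
theorem lintegral_littlewoodPaley {f : ℂ → ℂ} (hf : AnalyticOnNhd ℂ f (ball 0 1)) :
    ∫⁻ z in ball (0 : ℂ) 1, ENNReal.ofReal (‖deriv f z‖ ^ 2) *
        ENNReal.ofReal (Real.log (1 / ‖z‖)) =
      ENNReal.ofReal (Real.pi / 2) * ∑' j, ENNReal.ofReal (‖taylorCoeff f (j + 1)‖ ^ 2) := by
  rw [lintegral_ball_radial hf.deriv (w := fun s => ENNReal.ofReal (Real.log (1 / s)))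
    (by fun_prop), ← ENNReal.tsum_mul_left, ← ENNReal.tsum_mul_left]
  congr 1
  ext j
  have h : ∫⁻ s in Set.Ioo (0 : ℝ) 1, ENNReal.ofReal (s ^ (2 * j + 1)) *
      ENNReal.ofReal (Real.log (1 / s)) =
      ENNReal.ofReal ((1 : ℕ).factorial / (((2 * j + 1 : ℕ) : ℝ) + 1) ^ (1 + 1)) := by
    rw [← lintegral_log_pow]
    refine MeasureTheory.setLIntegral_congr_fun measurableSet_Ioo fun s hs => ?_
    have := hs.1
    simp only [pow_one]
    rw [ENNReal.ofReal_mul (by positivity)]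
  rw [h, ← ENNReal.ofReal_mul (by positivity), ← ENNReal.ofReal_mul (by positivity),
    ← ENNReal.ofReal_mul (by positivity), taylorCoeff_deriv]
  congr 1
  rw [norm_mul, mul_pow]
  have : ‖(j : ℂ) + 1‖ = j + 1 := by
    rw [← Nat.cast_succ, Complex.norm_natCast]; push_cast; ring
  rw [this]
  push_cast
  simp only [Nat.factorial]
  push_cast
  field_simp
  ring

/-! ### Non-univalent change of variables. -/

/-- The lower integral is superadditive without any measurability. This spares checking that inverse
branches of `φ` are measurable, and only this direction is needed. -/
theorem tsum_lintegral_le_lintegral_tsum {α ι : Type*} [MeasurableSpace α]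
    (μ : MeasureTheory.Measure α) (f : ι → α → ℝ≥0∞) :
    ∑' i, ∫⁻ x, f i x ∂μ ≤ ∫⁻ x, ∑' i, f i x ∂μ := by
  classical
  rw [ENNReal.tsum_eq_iSup_sum]
  refine iSup_le fun s => ?_
  have h : ∑ i ∈ s, ∫⁻ x, f i x ∂μ ≤ ∫⁻ x, ∑ i ∈ s, f i x ∂μ := by
    induction s using Finset.induction_on with
    | empty => simp
    | insert a s ha ih =>
      simp only [Finset.sum_insert ha]
      exact (add_le_add_right ih _).trans (MeasureTheory.le_lintegral_add _ _)
  exact h.trans (MeasureTheory.lintegral_mono fun x => ENNReal.sum_le_tsum s)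

theorem abs_det_smul_one (c : ℂ) : |(c • (1 : ℂ →L[ℝ] ℂ)).det| = ‖c‖ ^ 2 := by
  have h : (c • (1 : ℂ →L[ℝ] ℂ)).det = Complex.normSq c := by
    rw [← Algebra.norm_complex_apply, Algebra.norm_apply, ContinuousLinearMap.det]
    congr 1
  rw [h, Complex.normSq_eq_norm_sq, abs_of_nonneg (by positivity)]

/-- Any injective selection of preimages of `w` contributes at most `N_φ(w)`. -/
theorem tsum_le_nevanlinnaCounting {φ : ℂ → ℂ} (hφ : AnalyticOnNhd ℂ φ (ball 0 1)) (w : ℂ)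
    {ι : Type*} (z : ι → ℂ) (hz : Function.Injective z)
    (hmem : ∀ i, z i ∈ ball (0 : ℂ) 1 ∧ φ (z i) = w) :
    ∑' i, ENNReal.ofReal (Real.log (1 / ‖z i‖)) ≤ nevanlinnaCounting φ w := by
  rw [nevanlinnaCounting]
  split_ifs with h
  · exact le_top
  · let e : ι → {z : ℂ // z ∈ ball (0 : ℂ) 1 ∧ φ z = w} := fun i => ⟨z i, hmem i⟩
    have he : Function.Injective e := fun i j hij => hz (congrArg Subtype.val hij)
    refine le_trans (ENNReal.tsum_le_tsum fun i => ?_)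
      (ENNReal.tsum_comp_le_tsum_of_injective he _)
    refine le_mul_of_one_le_left' ?_
    have h0 : analyticOrderAt (fun u => φ u - w) (z i) ≠ 0 := by
      have : AnalyticAt ℂ (fun u => φ u - w) (z i) := (hφ _ (hmem i).1).sub analyticAt_const
      rw [this.analyticOrderAt_ne_zero, (hmem i).2, sub_self]
    rw [← ENat.toENNReal_one, ENat.toENNReal_le]
    exact Order.one_le_iff_pos.2 (pos_iff_ne_zero.2 h0)

/-- Multiplication by `c` scales distances by exactly `‖c‖`, so an error smaller than that cannot
identify two points. -/
theorem injOn_of_approximatesLinearOn {φ : ℂ → ℂ} {c : ℂ} {s : Set ℂ} {r : ℝ≥0}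
    (hr : (r : ℝ) < ‖c‖) (h : ApproximatesLinearOn φ (c • (1 : ℂ →L[ℝ] ℂ)) s r) :
    Set.InjOn φ s := by
  intro x hx y hy hxy
  have h1 := h x hx y hy
  rw [hxy, sub_self, zero_sub, norm_neg] at h1
  have h2 : ‖(c • (1 : ℂ →L[ℝ] ℂ)) (x - y)‖ = ‖c‖ * ‖x - y‖ := by simp
  rw [h2] at h1
  by_contra hne
  have : 0 < ‖x - y‖ := norm_pos_iff.2 (sub_ne_zero.2 hne)
  nlinarith

/-- The non-univalent change of variables, as an inequality. -/
theorem lintegral_comp_le_lintegral_nevanlinnaCounting {φ : ℂ → ℂ}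
    (hφ : AnalyticOnNhd ℂ φ (ball 0 1)) {A : Set ℂ} (hA : IsOpen A) (F : ℂ → ℝ≥0∞) :
    ∫⁻ z in ball (0 : ℂ) 1 ∩ φ ⁻¹' A, F (φ z) * ENNReal.ofReal (‖deriv φ z‖ ^ 2) *
        ENNReal.ofReal (Real.log (1 / ‖z‖)) ≤
      ∫⁻ w in A, F w * nevanlinnaCounting φ w := by
  classical
  set S : Set ℂ := ball (0 : ℂ) 1 ∩ φ ⁻¹' A with hS
  -- Critical points may be discarded, since the factor `‖deriv φ z‖ ^ 2` kills the integrand there.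
  set S₀ : Set ℂ := S ∩ deriv φ ⁻¹' {0}ᶜ with hS₀
  have hSo : IsOpen S := hφ.continuousOn.isOpen_inter_preimage isOpen_ball hA
  have hS₀o : IsOpen S₀ := (hφ.deriv.continuousOn.mono Set.inter_subset_left).isOpen_inter_preimage
    hSo isOpen_compl_singleton
  have hball : ∀ z ∈ S₀, z ∈ ball (0 : ℂ) 1 := fun z hz => hz.1.1
  set φ' : ℂ → ℂ →L[ℝ] ℂ := fun z => deriv φ z • (1 : ℂ →L[ℝ] ℂ) with hφ'
  have hderiv (s : Set ℂ) : ∀ z ∈ S₀ ∩ s, HasFDerivWithinAt φ (φ' z) (S₀ ∩ s) z := fun z hz =>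
    ((hφ z (hball z hz.1)).differentiableAt.hasDerivAt.complexToReal_fderiv).hasFDerivWithinAt
  obtain ⟨t, L, htd, htm, hSt, htL, hL⟩ :=
    exists_partition_approximatesLinearOn_of_hasFDerivWithinAt φ S₀ φ'
      (fun z hz => ((hφ z (hball z hz)).differentiableAt.hasDerivAt.complexToReal_fderiv
        ).hasFDerivWithinAt)
      -- Tolerance `‖M‖ / 2` forces injectivity on each piece. The value at `M = 0` only meets the
      -- demand that tolerances be nonzero; it never occurs when `S₀` is nonempty.
      (fun M => if M = 0 then 1 else ‖M‖₊ / 2) (fun M => by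
        split_ifs with h
        · exact one_ne_zero
        · simpa using h)
  set E : ℕ → Set ℂ := fun i => S₀ ∩ t i with hE
  have hEm (i : ℕ) : MeasurableSet (E i) := hS₀o.measurableSet.inter (htm i)
  have hEd : Pairwise (Function.onFun Disjoint E) := fun i j hij =>
    (htd hij).mono Set.inter_subset_right Set.inter_subset_right
  have hEu : S₀ = ⋃ i, E i := by
    rw [hE, ← Set.inter_iUnion, Set.inter_eq_self_of_subset_left hSt]
  have hinj (i : ℕ) : Set.InjOn φ (E i) := by
    rcases Set.eq_empty_or_nonempty S₀ with h | h
    · simp [hE, h]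
    · obtain ⟨y, hy, hLy⟩ := hL h i
      have hy0 : deriv φ y ≠ 0 := hy.2
      have h1 := htL i
      have hne : φ' y ≠ 0 := fun h0 => hy0 (by simpa [hφ'] using congrArg (fun M => M 1) h0)
      rw [hLy, if_neg hne] at h1
      refine injOn_of_approximatesLinearOn ?_ h1
      have h2 : ‖φ' y‖ = ‖deriv φ y‖ := by simp [hφ', norm_smul]
      have h3 : 0 < ‖deriv φ y‖ := norm_pos_iff.2 hy0
      push_cast
      rw [h2]
      linarith
  set lam : ℂ → ℝ≥0∞ := fun z => ENNReal.ofReal (Real.log (1 / ‖z‖)) with hlam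
  set inv : ℕ → ℂ → ℂ := fun i => Function.invFunOn φ (E i) with hinv
  set P : ℂ → ℝ≥0∞ := fun z => F (φ z) * ENNReal.ofReal (‖deriv φ z‖ ^ 2) * lam z with hP
  have hpiece (i : ℕ) : ∫⁻ z in E i, P z = ∫⁻ w in φ '' E i, F w * lam (inv i w) := by
    rw [MeasureTheory.lintegral_image_eq_lintegral_abs_det_fderiv_mul _ (hEm i)
      (hderiv (t i)) (hinj i)]
    refine MeasureTheory.setLIntegral_congr_fun (hEm i) fun z hz => ?_
    have : inv i (φ z) = z := (hinj i).leftInvOn_invFunOn hz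
    simp only [hP, hφ', abs_det_smul_one, this]
    ring
  have himg (i : ℕ) : MeasurableSet (φ '' E i) :=
    MeasureTheory.measurable_image_of_fderivWithin (hEm i) (hderiv (t i)) (hinj i)
  have himgA (i : ℕ) : φ '' E i ⊆ A := by
    rintro _ ⟨z, hz, rfl⟩
    exact hz.1.1.2
  have hrestrict : ∫⁻ z in S, P z = ∫⁻ z in S₀, P z := by
    rw [← MeasureTheory.lintegral_indicator hSo.measurableSet,
      ← MeasureTheory.lintegral_indicator hS₀o.measurableSet]
    congr 1
    ext z
    by_cases h1 : z ∈ S₀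
    · rw [Set.indicator_of_mem h1, Set.indicator_of_mem h1.1]
    · rw [Set.indicator_of_notMem h1]
      by_cases h2 : z ∈ S
      · have h3 : deriv φ z = 0 := by
          by_contra h
          exact h1 ⟨h2, h⟩
        rw [Set.indicator_of_mem h2]
        simp [hP, h3]
      · rw [Set.indicator_of_notMem h2]
  have hsplit : ∫⁻ z in S₀, P z = ∑' i, ∫⁻ z in E i, P z := by
    rw [hEu, MeasureTheory.lintegral_iUnion hEm hEd]
  calc ∫⁻ z in S, P z = ∑' i, ∫⁻ z in E i, P z := by rw [hrestrict, hsplit]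
    _ = ∑' i, ∫⁻ w in A, (φ '' E i).indicator (fun w => F w * lam (inv i w)) w := by
      congr 1
      ext i
      rw [hpiece, MeasureTheory.lintegral_indicator (himg i),
        MeasureTheory.Measure.restrict_restrict (himg i),
        Set.inter_eq_self_of_subset_left (himgA i)]
    _ ≤ ∫⁻ w in A, ∑' i, (φ '' E i).indicator (fun w => F w * lam (inv i w)) w :=
      tsum_lintegral_le_lintegral_tsum _ _
    _ ≤ ∫⁻ w in A, F w * nevanlinnaCounting φ w := by
      refine MeasureTheory.lintegral_mono fun w => ?_
      have h1 (i : ℕ) : (φ '' E i).indicator (fun w => F w * lam (inv i w)) w =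
          F w * {i | w ∈ φ '' E i}.indicator (fun i => lam (inv i w)) i := by
        by_cases h : w ∈ φ '' E i
        · rw [Set.indicator_of_mem h, Set.indicator_of_mem (show i ∈ {i | w ∈ φ '' E i} from h)]
        · rw [Set.indicator_of_notMem h,
            Set.indicator_of_notMem (show i ∉ {i | w ∈ φ '' E i} from h), mul_zero]
      simp only [h1]
      rw [ENNReal.tsum_mul_left, ← tsum_subtype]
      gcongr
      -- Each piece whose image contains `w` provides one preimage, and disjointness of the pieces
      -- makes these preimages distinct.
      have hmemE (i : {i | w ∈ φ '' E i}) : inv i w ∈ E i := Function.invFunOn_mem i.2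
      refine tsum_le_nevanlinnaCounting hφ w (fun i : {i | w ∈ φ '' E i} => inv i w) ?_
        fun i => ⟨hball _ (hmemE i).1, Function.invFunOn_eq i.2⟩
      intro i j hij
      by_contra hne
      have h2 := hEd (fun h => hne (Subtype.ext h) : (i : ℕ) ≠ j)
      refine Set.disjoint_left.1 h2 (hmemE i) ?_
      have := hmemE j
      simp only at hij
      rwa [← hij] at this

/-! ### Derivative estimates in `H²` and sufficiency of the counting condition. -/

theorem AnalyticOnNhd.iteratedDeriv_ball {f : ℂ → ℂ} (hf : AnalyticOnNhd ℂ f (ball 0 1)) (m : ℕ) :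
    AnalyticOnNhd ℂ (iteratedDeriv m f) (ball 0 1) := by
  rw [iteratedDeriv_eq_iterate]
  exact hf.iterated_deriv m

/-- Each coefficient is at most the norm, so a geometric series dominates. The exponent of `1 - ‖u‖`
is not sharp, but only compact subsets matter. -/
theorem norm_le_of_sum_sq {f : ℂ → ℂ} (hf : MemHardyTwo f) {u : ℂ} (hu : u ∈ ball (0 : ℂ) 1) :
    ‖f u‖ ≤ hardyTwoNorm f * (1 - ‖u‖)⁻¹ := by
  have hu1 : ‖u‖ < 1 := by simpa using hu
  have h := hasSum_taylorCoeff hf.1 hu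
  have hg := (hasSum_geometric_of_lt_one (norm_nonneg u) hu1).mul_left (hardyTwoNorm f)
  refine h.norm_le_of_bounded hg fun j => ?_
  rw [norm_mul, norm_pow]
  gcongr
  refine le_of_sq_le_sq ?_ (hardyTwoNorm_nonneg f)
  rw [hf.hardyTwoNorm_sq]
  exact hf.summable.le_tsum j fun i _ => by positivity

/-- Cauchy's estimate on a circle of radius `δ = (1 - ρ) / 2`, which stays at distance at least `δ`
from the unit circle. -/
theorem exists_norm_iteratedDeriv_le (m : ℕ) {ρ : ℝ} (hρ : ρ < 1) :
    ∃ K : ℝ, 0 ≤ K ∧ ∀ f, MemHardyTwo f → ∀ w : ℂ, ‖w‖ ≤ ρ →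
      ‖iteratedDeriv m f w‖ ≤ K * hardyTwoNorm f := by
  set δ := (1 - ρ) / 2 with hδ
  have hδ0 : 0 < δ := by rw [hδ]; linarith
  refine ⟨m.factorial * δ⁻¹ / δ ^ m, by positivity, fun f hf w hw => ?_⟩
  have hsub : closedBall w δ ⊆ ball (0 : ℂ) 1 := by
    intro u hu
    have h1 : ‖u - w‖ ≤ δ := by simpa [dist_eq_norm] using hu
    have h2 : ‖u‖ ≤ ‖u - w‖ + ‖w‖ := by simpa using norm_add_le (u - w) w
    rw [mem_ball_zero_iff]
    linarith
  have h := Complex.norm_iteratedDeriv_le_of_forall_mem_sphere_norm_le (c := w) (R := δ)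
    (C := hardyTwoNorm f * δ⁻¹) (f := f) m hδ0
    ((hf.1.differentiableOn.mono hsub).diffContOnCl_ball subset_rfl) (by
      intro u hu
      have h1 : ‖u - w‖ = δ := by simpa [dist_eq_norm] using hu
      have h2 : ‖u‖ ≤ ‖u - w‖ + ‖w‖ := by simpa using norm_add_le (u - w) w
      refine (norm_le_of_sum_sq hf (hsub (sphere_subset_closedBall hu))).trans ?_
      have := hardyTwoNorm_nonneg f
      gcongr
      linarith)
  refine h.trans (le_of_eq ?_)
  ring

theorem norm_taylorCoeff_iteratedDeriv_le (f : ℂ → ℂ) (m j : ℕ) :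
    ‖taylorCoeff (iteratedDeriv m f) j‖ ≤ ((j : ℝ) + m) ^ m * ‖taylorCoeff f (j + m)‖ := by
  induction m generalizing j with
  | zero => simp
  | succ m ih =>
    rw [iteratedDeriv_succ, taylorCoeff_deriv, norm_mul]
    have h1 : ‖(j : ℂ) + 1‖ = j + 1 := by
      rw [← Nat.cast_succ, Complex.norm_natCast]; push_cast; ring
    rw [h1]
    calc ((j : ℝ) + 1) * ‖taylorCoeff (iteratedDeriv m f) (j + 1)‖
        ≤ ((j : ℝ) + 1) * ((((j + 1 : ℕ) : ℝ) + m) ^ m * ‖taylorCoeff f (j + 1 + m)‖) := by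
          gcongr
          exact ih (j + 1)
      _ ≤ ((j : ℝ) + (m + 1 : ℕ)) * (((j : ℝ) + (m + 1 : ℕ)) ^ m * ‖taylorCoeff f (j + (m + 1))‖) := by
          have : j + 1 + m = j + (m + 1) := by ring
          rw [this]
          have h2 : ((j + 1 : ℕ) : ℝ) + m = j + (m + 1 : ℕ) := by push_cast; ring
          rw [h2]
          gcongr
          simp
      _ = _ := by ring

theorem MemHardyTwo.tsum_ofReal {f : ℂ → ℂ} (hf : MemHardyTwo f) :
    ∑' j, ENNReal.ofReal (‖taylorCoeff f j‖ ^ 2) = ENNReal.ofReal (hardyTwoNorm f ^ 2) := by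
  rw [hf.hardyTwoNorm_sq, ENNReal.ofReal_tsum_of_nonneg (fun j => by positivity) hf.summable]

theorem tsum_ofReal_add_le {f : ℂ → ℂ} (hf : MemHardyTwo f) (m : ℕ) :
    ∑' j, ENNReal.ofReal (‖taylorCoeff f (j + m)‖ ^ 2) ≤ ENNReal.ofReal (hardyTwoNorm f ^ 2) := by
  rw [← hf.tsum_ofReal]
  exact ENNReal.tsum_comp_le_tsum_of_injective (add_left_injective m) _

/-- The weighted area integral of `|f^{(n+1)}|²` is controlled by the Hardy norm. -/
theorem lintegral_iteratedDeriv_log_pow_le {f : ℂ → ℂ} (hf : MemHardyTwo f) (n : ℕ) :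
    ∫⁻ w in ball (0 : ℂ) 1, ENNReal.ofReal (‖iteratedDeriv (n + 1) f w‖ ^ 2) *
        ENNReal.ofReal (Real.log (1 / ‖w‖) ^ (2 * n + 1)) ≤
      ENNReal.ofReal (2 * Real.pi * ((2 * n + 1).factorial * ((n : ℝ) + 1) ^ (2 * n + 2)) *
        hardyTwoNorm f ^ 2) := by
  rw [lintegral_ball_radial (hf.1.iteratedDeriv_ball (n + 1))
    (w := fun s => ENNReal.ofReal (Real.log (1 / s) ^ (2 * n + 1))) (by fun_prop),
    mul_assoc, ENNReal.ofReal_mul (p := 2 * Real.pi) (by positivity),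
    ENNReal.ofReal_mul
      (p := (2 * n + 1).factorial * ((n : ℝ) + 1) ^ (2 * n + 2)) (by positivity)]
  gcongr
  refine le_trans ?_ (mul_le_mul_right (tsum_ofReal_add_le hf (n + 1)) _)
  rw [← ENNReal.tsum_mul_left]
  refine ENNReal.tsum_le_tsum fun j => ?_
  have h : ∫⁻ s in Set.Ioo (0 : ℝ) 1, ENNReal.ofReal (s ^ (2 * j + 1)) *
      ENNReal.ofReal (Real.log (1 / s) ^ (2 * n + 1)) =
      ENNReal.ofReal ((2 * n + 1).factorial / (((2 * j + 1 : ℕ) : ℝ) + 1) ^ (2 * n + 1 + 1)) := by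
    rw [← lintegral_log_pow]
    refine MeasureTheory.setLIntegral_congr_fun measurableSet_Ioo fun s hs => ?_
    have := hs.1
    rw [ENNReal.ofReal_mul (by positivity)]
  rw [h, ← ENNReal.ofReal_mul (by positivity), ← ENNReal.ofReal_mul (by positivity)]
  refine ENNReal.ofReal_le_ofReal ?_
  have h1 := norm_taylorCoeff_iteratedDeriv_le f (n + 1) j
  -- Comparing with `j + 1` lets the `2n+2` powers from differentiation cancel those of the
  -- logarithmic moment, uniformly in `j`.
  have h2 : (j : ℝ) + (n + 1 : ℕ) ≤ (n + 1) * (j + 1) := by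
    push_cast
    have : (0 : ℝ) ≤ n * j := by positivity
    nlinarith
  have h3 : ‖taylorCoeff (iteratedDeriv (n + 1) f) j‖ ≤
      (((n : ℝ) + 1) * (j + 1)) ^ (n + 1) * ‖taylorCoeff f (j + (n + 1))‖ :=
    h1.trans (by gcongr)
  calc ‖taylorCoeff (iteratedDeriv (n + 1) f) j‖ ^ 2 *
        ((2 * n + 1).factorial / (((2 * j + 1 : ℕ) : ℝ) + 1) ^ (2 * n + 1 + 1))
      ≤ ((((n : ℝ) + 1) * (j + 1)) ^ (n + 1) * ‖taylorCoeff f (j + (n + 1))‖) ^ 2 *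
        ((2 * n + 1).factorial / ((j : ℝ) + 1) ^ (2 * n + 1 + 1)) := by
        gcongr
        have : (0 : ℝ) ≤ j := by positivity
        linarith
    _ = _ := by
        have : ((j : ℝ) + 1) ≠ 0 := by positivity
        rw [mul_pow ((n : ℝ) + 1)]
        field_simp
        ring

/-- Littlewood–Paley read backwards: a finite area integral forces square-summable coefficients. The
factor `π/2 ≥ 1` is simply dropped. -/
theorem memHardyTwo_of_lintegral_le {G : ℂ → ℂ} (hG : AnalyticOnNhd ℂ G (ball 0 1)) {X : ℝ}
    (hX : 0 ≤ X) (h : ∫⁻ z in ball (0 : ℂ) 1, ENNReal.ofReal (‖deriv G z‖ ^ 2) *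
      ENNReal.ofReal (Real.log (1 / ‖z‖)) ≤ ENNReal.ofReal X) :
    MemHardyTwo G ∧ hardyTwoNorm G ^ 2 ≤ ‖G 0‖ ^ 2 + X := by
  have hpi : (1 : ℝ) ≤ Real.pi / 2 := by linarith [Real.pi_gt_three]
  have h1 : ∑' j, ENNReal.ofReal (‖taylorCoeff G (j + 1)‖ ^ 2) ≤ ENNReal.ofReal X := by
    rw [lintegral_littlewoodPaley hG] at h
    refine le_trans ?_ h
    refine le_mul_of_one_le_left' ?_
    rw [← ENNReal.ofReal_one]
    exact ENNReal.ofReal_le_ofReal hpi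
  have h2 : Summable fun j => ‖taylorCoeff G (j + 1)‖ ^ 2 := by
    have h3 := ENNReal.summable_toReal (ne_top_of_le_ne_top ENNReal.ofReal_ne_top h1)
    refine h3.congr fun j => ENNReal.toReal_ofReal (by positivity)
  have h3 : Summable fun j => ‖taylorCoeff G j‖ ^ 2 :=
    (summable_nat_add_iff (f := fun j => ‖taylorCoeff G j‖ ^ 2) 1).1 h2
  have hmem : MemHardyTwo G := memHardyTwo_iff.2 ⟨hG, h3⟩
  refine ⟨hmem, ?_⟩
  rw [hmem.hardyTwoNorm_sq, h3.tsum_eq_zero_add]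
  have h4 : taylorCoeff G 0 = G 0 := by simp [taylorCoeff]
  rw [h4]
  gcongr
  rw [← ENNReal.ofReal_tsum_of_nonneg (fun j => by positivity) h2] at h1
  exact (ENNReal.ofReal_le_ofReal_iff hX).1 h1

theorem analyticOnNhd_compDiff {φ : ℂ → ℂ} (hφ : IsAnalyticSelfMap φ) (n : ℕ) {f : ℂ → ℂ}
    (hf : AnalyticOnNhd ℂ f (ball 0 1)) : AnalyticOnNhd ℂ (compDiff φ n f) (ball 0 1) :=
  (hf.iteratedDeriv_ball n).comp hφ.1 hφ.2

theorem deriv_compDiff {φ : ℂ → ℂ} (hφ : IsAnalyticSelfMap φ) (n : ℕ) {f : ℂ → ℂ}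
    (hf : AnalyticOnNhd ℂ f (ball 0 1)) {z : ℂ} (hz : z ∈ ball (0 : ℂ) 1) :
    deriv (compDiff φ n f) z = iteratedDeriv (n + 1) f (φ z) * deriv φ z := by
  have h1 := (hf.iteratedDeriv_ball n (φ z) (hφ.2 hz)).differentiableAt.hasDerivAt
  have h2 := (hφ.1 z hz).differentiableAt.hasDerivAt
  rw [iteratedDeriv_succ]
  exact (h1.comp z h2).deriv

theorem countingBigO_iff {φ : ℂ → ℂ} {k : ℕ} : CountingBigO φ k ↔
    ∃ C : ℝ≥0, ∃ R : ℝ, 0 < R ∧ R < 1 ∧ ∀ w : ℂ, R < ‖w‖ → ‖w‖ < 1 →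
      nevanlinnaCounting φ w ≤ C * ENNReal.ofReal (Real.log (1 / ‖w‖) ^ k) := by
  refine exists_congr fun C => ?_
  rw [eventually_comap]
  constructor
  · intro h
    obtain ⟨R, hR, h⟩ := (mem_nhdsLT_iff_exists_Ioo_subset' (show (0 : ℝ) < 1 by norm_num)).1 h
    refine ⟨max R (1 / 2), by positivity, max_lt hR (by norm_num), fun w h1 h2 => ?_⟩
    exact h ⟨(le_max_left _ _).trans_lt h1, h2⟩ w rfl
  · rintro ⟨R, -, hR, h⟩
    filter_upwards [Ioo_mem_nhdsLT hR] with s hs w hw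
    subst hw
    exact h w hs.1 hs.2

theorem isBoundedOnHardyTwo_of_countingBigO {φ : ℂ → ℂ} (hφ : IsAnalyticSelfMap φ) (n : ℕ)
    (h : CountingBigO φ (2 * n + 1)) : IsBoundedOnHardyTwo (compDiff φ n) := by
  obtain ⟨C, R, hR0, hR1, hN⟩ := countingBigO_iff.1 h
  obtain ⟨K₁, hK₁, hb₁⟩ := exists_norm_iteratedDeriv_le (n + 1) hR1
  have hφ0 : ‖φ 0‖ < 1 := by simpa using hφ.2 (show (0 : ℂ) ∈ ball (0 : ℂ) 1 by simp)
  obtain ⟨K₀, hK₀, hb₀⟩ := exists_norm_iteratedDeriv_le n hφ0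
  have hφH : MemHardyTwo φ := memHardyTwo_of_bounded hφ.1 (M := 1) fun z hz => by
    have := hφ.2 hz
    rw [mem_ball_zero_iff] at this
    exact this.le
  set K₂ : ℝ := 2 * Real.pi * ((2 * n + 1).factorial * ((n : ℝ) + 1) ^ (2 * n + 2)) with hK₂
  -- The first term serves the region `|φ| > R`, through `N_φ`; the second serves `|φ| ≤ R`, where
  -- `K₁` bounds the derivative of order `n + 1`.
  set K₃ : ℝ := C * K₂ + K₁ ^ 2 * (Real.pi / 2 * hardyTwoNorm φ ^ 2) with hK₃
  have hK₃0 : 0 ≤ K₃ := by positivity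
  set A : Set ℂ := ball (0 : ℂ) 1 ∩ {w | R < ‖w‖} with hA
  have hAo : IsOpen A := isOpen_ball.inter (isOpen_lt continuous_const continuous_norm)
  have key (f : ℂ → ℂ) (hf : MemHardyTwo f) :
      ∫⁻ z in ball (0 : ℂ) 1, ENNReal.ofReal (‖deriv (compDiff φ n f) z‖ ^ 2) *
        ENNReal.ofReal (Real.log (1 / ‖z‖)) ≤ ENNReal.ofReal (K₃ * hardyTwoNorm f ^ 2) := by
    have hT : MeasurableSet (ball (0 : ℂ) 1 ∩ φ ⁻¹' A) :=
      (hφ.1.continuousOn.isOpen_inter_preimage isOpen_ball hAo).measurableSet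
    rw [← MeasureTheory.lintegral_inter_add_sdiff _ (ball (0 : ℂ) 1) hT, ← Set.inter_assoc,
      Set.inter_self, hK₃, add_mul, ENNReal.ofReal_add (by positivity) (by positivity)]
    refine add_le_add ?_ ?_
    · calc ∫⁻ z in ball (0 : ℂ) 1 ∩ φ ⁻¹' A, ENNReal.ofReal (‖deriv (compDiff φ n f) z‖ ^ 2) *
            ENNReal.ofReal (Real.log (1 / ‖z‖))
          = ∫⁻ z in ball (0 : ℂ) 1 ∩ φ ⁻¹' A,
            (fun w => ENNReal.ofReal (‖iteratedDeriv (n + 1) f w‖ ^ 2)) (φ z) *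
              ENNReal.ofReal (‖deriv φ z‖ ^ 2) * ENNReal.ofReal (Real.log (1 / ‖z‖)) := by
            refine MeasureTheory.setLIntegral_congr_fun hT fun z hz => ?_
            dsimp only
            rw [deriv_compDiff hφ n hf.1 hz.1, norm_mul, mul_pow,
              ENNReal.ofReal_mul (by positivity)]
        _ ≤ ∫⁻ w in A, ENNReal.ofReal (‖iteratedDeriv (n + 1) f w‖ ^ 2) *
            nevanlinnaCounting φ w :=
            lintegral_comp_le_lintegral_nevanlinnaCounting hφ.1 hAo _
        _ ≤ ∫⁻ w in A, C * (ENNReal.ofReal (‖iteratedDeriv (n + 1) f w‖ ^ 2) *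
            ENNReal.ofReal (Real.log (1 / ‖w‖) ^ (2 * n + 1))) := by
            refine MeasureTheory.setLIntegral_mono' hAo.measurableSet fun w hw => ?_
            rw [mul_left_comm]
            gcongr
            exact hN w hw.2 (by simpa using hw.1)
        _ = C * ∫⁻ w in A, ENNReal.ofReal (‖iteratedDeriv (n + 1) f w‖ ^ 2) *
            ENNReal.ofReal (Real.log (1 / ‖w‖) ^ (2 * n + 1)) :=
            MeasureTheory.lintegral_const_mul' _ _ ENNReal.coe_ne_top
        _ ≤ C * ENNReal.ofReal (K₂ * hardyTwoNorm f ^ 2) := by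
            gcongr
            exact (MeasureTheory.lintegral_mono_set Set.inter_subset_left).trans
              (lintegral_iteratedDeriv_log_pow_le hf n)
        _ = ENNReal.ofReal (C * K₂ * hardyTwoNorm f ^ 2) := by
            rw [mul_assoc (C : ℝ), ENNReal.ofReal_mul (p := C) (by positivity),
              ENNReal.ofReal_coe_nnreal]
    · calc ∫⁻ z in ball (0 : ℂ) 1 \ (ball (0 : ℂ) 1 ∩ φ ⁻¹' A),
            ENNReal.ofReal (‖deriv (compDiff φ n f) z‖ ^ 2) *
            ENNReal.ofReal (Real.log (1 / ‖z‖))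
          ≤ ∫⁻ z in ball (0 : ℂ) 1 \ (ball (0 : ℂ) 1 ∩ φ ⁻¹' A),
            ENNReal.ofReal (K₁ ^ 2 * hardyTwoNorm f ^ 2) * (ENNReal.ofReal (‖deriv φ z‖ ^ 2) *
            ENNReal.ofReal (Real.log (1 / ‖z‖))) := by
            refine MeasureTheory.setLIntegral_mono' (measurableSet_ball.diff hT) fun z hz => ?_
            rw [← mul_assoc, ← ENNReal.ofReal_mul (p := K₁ ^ 2 * hardyTwoNorm f ^ 2) (by positivity),
              deriv_compDiff hφ n hf.1 hz.1, norm_mul, mul_pow, ← mul_pow K₁]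
            gcongr
            refine hb₁ f hf _ ?_
            by_contra hlt
            exact hz.2 ⟨hz.1, hφ.2 hz.1, not_le.1 hlt⟩
        _ = ENNReal.ofReal (K₁ ^ 2 * hardyTwoNorm f ^ 2) *
            ∫⁻ z in ball (0 : ℂ) 1 \ (ball (0 : ℂ) 1 ∩ φ ⁻¹' A),
              ENNReal.ofReal (‖deriv φ z‖ ^ 2) * ENNReal.ofReal (Real.log (1 / ‖z‖)) :=
            MeasureTheory.lintegral_const_mul' _ _ ENNReal.ofReal_ne_top
        _ ≤ ENNReal.ofReal (K₁ ^ 2 * hardyTwoNorm f ^ 2) *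
            ENNReal.ofReal (Real.pi / 2 * hardyTwoNorm φ ^ 2) := by
            gcongr
            refine (MeasureTheory.lintegral_mono_set Set.sdiff_subset).trans ?_
            rw [lintegral_littlewoodPaley hφ.1, ENNReal.ofReal_mul (by positivity)]
            gcongr
            exact tsum_ofReal_add_le hφH 1
        _ = _ := by
            rw [← ENNReal.ofReal_mul (by positivity)]
            congr 1
            ring
  have main (f : ℂ → ℂ) (hf : MemHardyTwo f) :=
    memHardyTwo_of_lintegral_le (analyticOnNhd_compDiff hφ n hf.1) (by positivity) (key f hf)
  refine ⟨fun f hf => (main f hf).1, Real.sqrt (K₀ ^ 2 + K₃), fun f hf => ?_⟩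
  have hnn := hardyTwoNorm_nonneg f
  refine le_of_sq_le_sq ?_ (by positivity)
  rw [mul_pow, Real.sq_sqrt (by positivity), add_mul]
  refine (main f hf).2.trans ?_
  gcongr
  rw [← mul_pow]
  gcongr
  exact hb₀ f hf _ le_rfl

/-! ### A polynomial majorant of the logarithm. -/

/-- Coefficients of the polynomial `Ψ` with `(t Ψ'(t))' = (p + 1) (1 - t) ^ p / 2` and `Ψ(0) = 0`. -/
def logPolyCoeff (p k : ℕ) : ℝ := (-1) ^ k * (p + 1).choose (k + 1) / (2 * (k + 1))

/-- A polynomial majorant, up to an additive constant, of `t ↦ log t / 2` on `(0, 1]`. -/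
def logPoly (p : ℕ) (t : ℝ) : ℝ := ∑ k ∈ Finset.range (p + 1), logPolyCoeff p k * t ^ (k + 1)

/-- The operator `P ↦ (tP')'` multiplies the coefficient of `t^(k+1)` by `(k+1)²`, just as
`|(F^(k+1))'|²` does for powers of an analytic function. The identity is then the binomial theorem.
-/
theorem sum_sq_logPolyCoeff (p : ℕ) (t : ℝ) :
    ∑ k ∈ Finset.range (p + 1), logPolyCoeff p k * ((k : ℝ) + 1) ^ 2 * t ^ k =
      (p + 1) / 2 * (1 - t) ^ p := by
  rw [sub_eq_neg_add, add_pow, Finset.mul_sum]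
  refine Finset.sum_congr rfl fun k _ => ?_
  have h : ((p + 1 : ℕ) : ℝ) * (p.choose k : ℝ) = ((p + 1).choose (k + 1) : ℝ) * ((k + 1 : ℕ) : ℝ) := by
    exact_mod_cast Nat.add_one_mul_choose_eq p k
  push_cast at h
  have hk : (k : ℝ) + 1 ≠ 0 := by positivity
  rw [logPolyCoeff, neg_pow t k]
  field_simp
  rw [mul_assoc ((p + 1).choose (k + 1) : ℝ), mul_comm ((p + 1).choose (k + 1) : ℝ)]
  simp only [one_pow, mul_one]
  linear_combination -(t ^ k) * h

theorem hasDerivAt_logPoly (p : ℕ) {t : ℝ} (ht : t ≠ 0) :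
    HasDerivAt (logPoly p) ((1 - (1 - t) ^ (p + 1)) / (2 * t)) t := by
  have h1 : HasDerivAt (logPoly p)
      (∑ k ∈ Finset.range (p + 1), logPolyCoeff p k * (((k + 1 : ℕ) : ℝ) * t ^ k)) t := by
    unfold logPoly
    refine HasDerivAt.fun_sum fun k _ => ?_
    exact (hasDerivAt_pow (k + 1) t).const_mul _
  convert h1 using 1
  rw [sub_eq_neg_add 1 t, add_pow, Finset.sum_range_succ']
  rw [div_eq_iff (by positivity), Finset.sum_mul]
  simp only [pow_zero, one_pow, mul_one, Nat.choose_zero_right, Nat.cast_one, sub_add_cancel_right,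
    ← Finset.sum_neg_distrib]
  refine Finset.sum_congr rfl fun k _ => ?_
  have hk : (k : ℝ) + 1 ≠ 0 := by positivity
  rw [logPolyCoeff, neg_pow t]
  push_cast
  field_simp
  ring

theorem hasDerivAt_logPoly_sub_log (p : ℕ) {t : ℝ} (ht : 0 < t) :
    HasDerivAt (fun t => logPoly p t - Real.log t / 2) (-((1 - t) ^ (p + 1) / (2 * t))) t := by
  refine ((hasDerivAt_logPoly p ht.ne').sub
    ((Real.hasDerivAt_log ht.ne').div_const 2)).congr_deriv ?_
  field_simp
  ring

theorem log_le_logPoly (p : ℕ) {t : ℝ} (h0 : 0 < t) (h1 : t ≤ 1) :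
    Real.log t / 2 ≤ logPoly p t - logPoly p 1 := by
  have h : AntitoneOn (fun t => logPoly p t - Real.log t / 2) (Set.Ioc 0 1) := by
    refine antitoneOn_of_deriv_nonpos (convex_Ioc 0 1)
      (fun t ht => (hasDerivAt_logPoly_sub_log p ht.1).continuousAt.continuousWithinAt) ?_ ?_
    · rw [interior_Ioc]
      exact fun t ht => (hasDerivAt_logPoly_sub_log p ht.1).differentiableAt.differentiableWithinAt
    · rw [interior_Ioc]
      intro t ht
      rw [(hasDerivAt_logPoly_sub_log p ht.1).deriv, Left.neg_nonpos_iff]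
      have := ht.1
      have : 0 ≤ 1 - t := by linarith [ht.2]
      positivity
  have := h ⟨h0, h1⟩ ⟨one_pos, le_rfl⟩ h1
  simp only [Real.log_one, zero_div, sub_zero] at this
  linarith

/-- The majorant touches `log t / 2` at `t = 1` to high order: the derivative of the gap is
`-(1-t)^(p+1)/(2t)`, and `2t ≥ 1` here. -/
theorem logPoly_sub_log_le (p : ℕ) {t : ℝ} (h0 : 1 / 2 ≤ t) (h1 : t ≤ 1) :
    logPoly p t - logPoly p 1 - Real.log t / 2 ≤ (1 - t) ^ (p + 2) := by
  have hd (t : ℝ) (ht : 0 < t) : HasDerivAt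
      (fun t => (logPoly p t - Real.log t / 2) - (1 - t) ^ (p + 2))
      (-((1 - t) ^ (p + 1) / (2 * t)) - ((p + 2 : ℕ) : ℝ) * (1 - t) ^ (p + 1) * (-1)) t := by
    refine (hasDerivAt_logPoly_sub_log p ht).sub ?_
    exact ((hasDerivAt_id' t).const_sub 1).fun_pow (p + 2)
  have h : MonotoneOn (fun t => (logPoly p t - Real.log t / 2) - (1 - t) ^ (p + 2))
      (Set.Icc (1 / 2) 1) := by
    have hpos (t : ℝ) (ht : t ∈ Set.Icc (1 / 2 : ℝ) 1) : 0 < t := by linarith [ht.1]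
    refine monotoneOn_of_deriv_nonneg (convex_Icc _ _)
      (fun t ht => (hd t (hpos t ht)).continuousAt.continuousWithinAt) ?_ ?_
    · exact fun t ht => (hd t (hpos t (interior_subset ht))).differentiableAt.differentiableWithinAt
    · intro t ht
      have ht' := interior_subset ht
      have h2 := hpos t ht'
      rw [(hd t h2).deriv]
      have h3 : 0 ≤ (1 - t) ^ (p + 1) := pow_nonneg (by linarith [ht'.2]) _
      have h4 : (1 - t) ^ (p + 1) / (2 * t) ≤ (1 - t) ^ (p + 1) :=
        div_le_self h3 (by linarith [ht'.1])
      push_cast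
      nlinarith [mul_nonneg (Nat.cast_nonneg (α := ℝ) p) h3]
  have := h ⟨h0, h1⟩ ⟨by norm_num, le_rfl⟩ h1
  simp only [Real.log_one, zero_div, sub_zero, sub_self] at this
  rw [zero_pow (by omega)] at this
  linarith

/-! ### Jensen's formula and the control of zeros by area integrals. -/

theorem circleAverage_logPoly {F : ℂ → ℂ} (hF : AnalyticOnNhd ℂ F (ball 0 1)) (p : ℕ) {r : ℝ}
    (h0 : 0 ≤ r) (h1 : r < 1) :
    Real.circleAverage (fun z => logPoly p (‖F z‖ ^ 2)) 0 r =
      ∑ k ∈ Finset.range (p + 1), logPolyCoeff p k * sqMean (fun z => F z ^ (k + 1)) r := by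
  unfold logPoly
  rw [Real.circleAverage_fun_sum]
  · refine Finset.sum_congr rfl fun k _ => ?_
    rw [sqMean, ← smul_eq_mul, ← Real.circleAverage_fun_smul]
    simp only [norm_pow, ← pow_mul, mul_comm 2, smul_eq_mul]
  · intro k _
    exact Continuous.intervalIntegrable
      ((((continuous_comp_circleMap hF h0 h1).norm.pow 2).pow (k + 1)).const_mul _) _ _

/-- A one-sided form of Jensen's formula, for finitely many zeros. -/
theorem sum_analyticOrderAt_mul_log_le {F : ℂ → ℂ} {r : ℝ} (hr : 0 < r)
    (hF : AnalyticOnNhd ℂ F (closedBall 0 r)) (hF0 : F 0 ≠ 0) (s : Finset ℂ)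
    (hs : ∀ z ∈ s, ‖z‖ ≤ r) :
    ∑ z ∈ s, ((analyticOrderAt F z).toNat : ℝ) * Real.log (r / ‖z‖) ≤
      Real.circleAverage (fun z => Real.log ‖F z‖) 0 r - Real.log ‖F 0‖ := by
  classical
  have habs : |r| = r := abs_of_pos hr
  have hF' : AnalyticOnNhd ℂ F (closedBall 0 |r|) := by rwa [habs]
  rw [hF'.circleAverage_log_norm hr.ne' hF0, add_sub_cancel_right, habs]
  set D := MeromorphicOn.divisor F (closedBall (0 : ℂ) r) with hD
  have hDfin : (Function.support D).Finite := D.finiteSupport (isCompact_closedBall 0 r)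
  have hDnn (u : ℂ) : 0 ≤ D u := MeromorphicOn.AnalyticOnNhd.divisor_nonneg hF u
  -- All terms of Jensen's sum are nonnegative, so those outside `s` can be dropped.
  rw [finsum_eq_sum_of_support_subset (s := hDfin.toFinset ∪ s)]
  · refine le_trans (le_of_eq ?_) (Finset.sum_le_sum_of_subset_of_nonneg
      (Finset.subset_union_right (s₁ := hDfin.toFinset)) ?_)
    · refine Finset.sum_congr rfl fun z hz => ?_
      have hz' : z ∈ closedBall (0 : ℂ) r := by simpa using hs z hz
      have : (D z : ℤ) = (analyticOrderAt F z).toNat := by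
        rw [hD, MeromorphicOn.AnalyticOnNhd.divisor_apply hF hz']
        cases analyticOrderAt F z with
        | top => simp
        | coe n => simp
      rw [this, zero_sub, norm_neg, div_eq_mul_inv]
      simp
    · intro z _ _
      by_cases hz : z ∈ closedBall (0 : ℂ) r
      · refine mul_nonneg (by exact_mod_cast hDnn z) ?_
        rw [zero_sub, norm_neg, ← div_eq_mul_inv]
        rcases eq_or_ne z 0 with rfl | hz0
        · simp
        · refine Real.log_nonneg ((one_le_div (norm_pos_iff.2 hz0)).2 (by simpa using hz))
      · have : D z = 0 := D.apply_eq_zero_of_notMem hz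
        simp [this]
  · intro z hz
    simp only [Finset.coe_union, Set.Finite.coe_toFinset]
    left
    intro h
    exact hz (by simp [h])

theorem circleAverage_log_le {F : ℂ → ℂ} (hF : AnalyticOnNhd ℂ F (ball 0 1)) (hF0 : F 0 ≠ 0)
    (hF1 : ∀ z ∈ ball (0 : ℂ) 1, ‖F z‖ ≤ 1) (p : ℕ) {r : ℝ} (h0 : 0 < r) (h1 : r < 1) :
    Real.circleAverage (fun z => Real.log ‖F z‖) 0 r ≤
      Real.circleAverage (fun z => logPoly p (‖F z‖ ^ 2)) 0 r - logPoly p 1 := by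
  classical
  have hsub : sphere (0 : ℂ) |r| ⊆ ball (0 : ℂ) 1 := by
    rw [abs_of_pos h0]
    exact sphere_subset_ball h1
  have hc := continuous_comp_circleMap hF h0.le h1
  have hP : CircleIntegrable (fun z => logPoly p (‖F z‖ ^ 2)) 0 r := by
    have : Continuous (logPoly p) := by unfold logPoly; fun_prop
    exact Continuous.intervalIntegrable (this.comp (hc.norm.pow 2)) _ _
  have hcod : F ⁻¹' {0}ᶜ ∈ codiscreteWithin (sphere (0 : ℂ) |r|) := by
    refine codiscreteWithin_mono hsub ?_
    exact hF.preimage_zero_mem_codiscreteWithin (x := 0) hF0 (by simp)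
      ((convex_ball _ _).isConnected ⟨0, by simp⟩)
  -- Since `Real.log 0 = 0`, the majorization fails at zeros of `F`. Redefining the function on this
  -- discrete exceptional set leaves the circle average unchanged.
  set g : ℂ → ℝ := fun z => if F z = 0 then logPoly p 0 - logPoly p 1 else Real.log ‖F z‖ with hg
  have heq : (fun z => Real.log ‖F z‖) =ᶠ[codiscreteWithin (sphere (0 : ℂ) |r|)] g := by
    filter_upwards [hcod] with z hz
    have : F z ≠ 0 := hz
    simp [hg, this]
  have hLI : CircleIntegrable (fun z => Real.log ‖F z‖) 0 r :=
    (hF.mono hsub).meromorphicOn.circleIntegrable_log_norm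
  rw [Real.circleAverage_congr_codiscreteWithin heq h0.ne',
    ← Real.circleAverage_const (logPoly p 1) 0 r, ← Real.circleAverage_fun_sub hP (by simp)]
  refine Real.circleAverage_mono (hLI.congr_codiscreteWithin heq) (hP.sub (by simp)) fun z hz => ?_
  simp only [hg]
  split_ifs with h
  · simp [h]
  · have hpos : 0 < ‖F z‖ := norm_pos_iff.2 h
    have := log_le_logPoly p (t := ‖F z‖ ^ 2) (by positivity)
      (pow_le_one₀ (norm_nonneg _) (hF1 z (hsub hz)))
    rw [Real.log_pow] at this
    push_cast at this
    linarith

/-- The coefficients of `logPoly` alternate in sign, so combining Littlewood–Paley identities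
requires a real-valued form with integrability. -/
theorem MemHardyTwo.integrableOn_deriv_sq {u : ℂ → ℂ} (hu : MemHardyTwo u) :
    MeasureTheory.IntegrableOn (fun z => ‖deriv u z‖ ^ 2 * Real.log (1 / ‖z‖)) (ball 0 1) ∧
    ∫ z in ball (0 : ℂ) 1, ‖deriv u z‖ ^ 2 * Real.log (1 / ‖z‖) =
      Real.pi / 2 * (hardyTwoNorm u ^ 2 - ‖u 0‖ ^ 2) := by
  have h := lintegral_littlewoodPaley hu.1
  have hs := (summable_nat_add_iff (f := fun j => ‖taylorCoeff u j‖ ^ 2) 1).2 hu.summable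
  have hnn : ∀ᵐ z ∂(MeasureTheory.volume.restrict (ball (0 : ℂ) 1)),
      0 ≤ ‖deriv u z‖ ^ 2 * Real.log (1 / ‖z‖) := by
    refine (MeasureTheory.ae_restrict_iff' measurableSet_ball).2 (.of_forall fun z hz => ?_)
    refine mul_nonneg (by positivity) ?_
    rcases eq_or_ne z 0 with rfl | hz0
    · simp
    · refine Real.log_nonneg ((one_le_div (norm_pos_iff.2 hz0)).2 ?_)
      simpa using (mem_ball_zero_iff.1 hz).le
  have hm : MeasureTheory.AEStronglyMeasurable
      (fun z => ‖deriv u z‖ ^ 2 * Real.log (1 / ‖z‖))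
      (MeasureTheory.volume.restrict (ball (0 : ℂ) 1)) := by
    refine ((hu.1.deriv.continuousOn.norm.pow 2).aestronglyMeasurable measurableSet_ball).mul ?_
    exact Measurable.aestronglyMeasurable (by fun_prop)
  have h2 : ∫⁻ z in ball (0 : ℂ) 1, ENNReal.ofReal (‖deriv u z‖ ^ 2 * Real.log (1 / ‖z‖)) =
      ENNReal.ofReal (Real.pi / 2 * (hardyTwoNorm u ^ 2 - ‖u 0‖ ^ 2)) := by
    have h3 : hardyTwoNorm u ^ 2 - ‖u 0‖ ^ 2 = ∑' j, ‖taylorCoeff u (j + 1)‖ ^ 2 := by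
      rw [hu.hardyTwoNorm_sq, hu.summable.tsum_eq_zero_add]
      simp [taylorCoeff]
    rw [h3, ENNReal.ofReal_mul (by positivity),
      ENNReal.ofReal_tsum_of_nonneg (fun j => by positivity) hs, ← h]
    congr 1
    ext z
    rw [ENNReal.ofReal_mul (by positivity)]
  refine ⟨⟨hm, ?_⟩, ?_⟩
  · rw [MeasureTheory.hasFiniteIntegral_iff_ofReal hnn, h2]
    exact ENNReal.ofReal_lt_top
  · rw [MeasureTheory.integral_eq_lintegral_of_nonneg_ae hnn hm, h2, ENNReal.toReal_ofReal]
    have h3 : hardyTwoNorm u ^ 2 - ‖u 0‖ ^ 2 = ∑' j, ‖taylorCoeff u (j + 1)‖ ^ 2 := by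
      rw [hu.hardyTwoNorm_sq, hu.summable.tsum_eq_zero_add]
      simp [taylorCoeff]
    rw [h3]
    have : 0 ≤ ∑' j, ‖taylorCoeff u (j + 1)‖ ^ 2 := tsum_nonneg fun j => by positivity
    positivity

theorem memHardyTwo_pow {F : ℂ → ℂ} (hF : AnalyticOnNhd ℂ F (ball 0 1))
    (hF1 : ∀ z ∈ ball (0 : ℂ) 1, ‖F z‖ ≤ 1) (k : ℕ) : MemHardyTwo (fun z => F z ^ k) :=
  memHardyTwo_of_bounded (hF.fun_pow k) (M := 1) fun z hz => by
    rw [norm_pow]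
    exact pow_le_one₀ (norm_nonneg _) (hF1 z hz)

/-- A differential inequality between `F` and `G` yields one between their Hardy space means. -/
theorem sum_logPolyCoeff_mul_norm_sq_le {F G : ℂ → ℂ} (hF : AnalyticOnNhd ℂ F (ball 0 1))
    (hF1 : ∀ z ∈ ball (0 : ℂ) 1, ‖F z‖ ≤ 1) (hG : MemHardyTwo G) (p : ℕ) {K : ℝ} (hK : 0 ≤ K)
    (h : ∀ z ∈ ball (0 : ℂ) 1,
      ((p : ℝ) + 1) / 2 * (1 - ‖F z‖ ^ 2) ^ p * ‖deriv F z‖ ^ 2 ≤ K * ‖deriv G z‖ ^ 2) :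
    ∑ k ∈ Finset.range (p + 1), logPolyCoeff p k * hardyTwoNorm (fun z => F z ^ (k + 1)) ^ 2 -
      logPoly p (‖F 0‖ ^ 2) ≤ K * hardyTwoNorm G ^ 2 := by
  have hH (k : ℕ) := memHardyTwo_pow hF hF1 (k + 1)
  -- The alternating sum collapses, by `sum_sq_logPolyCoeff`, to the nonnegative density in the
  -- hypothesis.
  have hmono : ∫ z in ball (0 : ℂ) 1, ∑ k ∈ Finset.range (p + 1), logPolyCoeff p k *
      (‖deriv (fun z => F z ^ (k + 1)) z‖ ^ 2 * Real.log (1 / ‖z‖)) ≤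
      ∫ z in ball (0 : ℂ) 1, K * (‖deriv G z‖ ^ 2 * Real.log (1 / ‖z‖)) := by
    refine MeasureTheory.setIntegral_mono_on ?_ (hG.integrableOn_deriv_sq.1.const_mul K)
      measurableSet_ball fun z hz => ?_
    · exact MeasureTheory.integrable_finsetSum _ fun k _ =>
        (hH k).integrableOn_deriv_sq.1.const_mul _
    · have hlog : 0 ≤ Real.log (1 / ‖z‖) := by
        rcases eq_or_ne z 0 with rfl | hz0
        · simp
        · refine Real.log_nonneg ((one_le_div (norm_pos_iff.2 hz0)).2 ?_)
          simpa using (mem_ball_zero_iff.1 hz).le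
      have hd (k : ℕ) : deriv (fun z => F z ^ (k + 1)) z = (k + 1) * F z ^ k * deriv F z := by
        rw [deriv_fun_pow (hF z hz).differentiableAt]
        simp
      have hn (k : ℕ) : ‖(k : ℂ) + 1‖ = k + 1 := by
        rw [← Nat.cast_succ, Complex.norm_natCast]; push_cast; ring
      calc ∑ k ∈ Finset.range (p + 1), logPolyCoeff p k *
            (‖deriv (fun z => F z ^ (k + 1)) z‖ ^ 2 * Real.log (1 / ‖z‖))
          = (∑ k ∈ Finset.range (p + 1), logPolyCoeff p k * ((k : ℝ) + 1) ^ 2 *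
              (‖F z‖ ^ 2) ^ k) * ‖deriv F z‖ ^ 2 * Real.log (1 / ‖z‖) := by
            rw [Finset.sum_mul, Finset.sum_mul]
            refine Finset.sum_congr rfl fun k _ => ?_
            rw [hd, norm_mul, norm_mul, hn, norm_pow]
            ring
        _ ≤ K * ‖deriv G z‖ ^ 2 * Real.log (1 / ‖z‖) := by
            rw [sum_sq_logPolyCoeff]
            exact mul_le_mul_of_nonneg_right (h z hz) hlog
        _ = _ := by ring
  rw [MeasureTheory.integral_finsetSum _ fun k _ =>
    (hH k).integrableOn_deriv_sq.1.const_mul _, MeasureTheory.integral_const_mul,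
    hG.integrableOn_deriv_sq.2] at hmono
  simp only [MeasureTheory.integral_const_mul, (hH _).integrableOn_deriv_sq.2] at hmono
  have hpi : 0 < Real.pi / 2 := by positivity
  have h1 : ∑ k ∈ Finset.range (p + 1), logPolyCoeff p k * (Real.pi / 2 *
      (hardyTwoNorm (fun z => F z ^ (k + 1)) ^ 2 - ‖F 0 ^ (k + 1)‖ ^ 2)) =
      Real.pi / 2 * (∑ k ∈ Finset.range (p + 1),
        logPolyCoeff p k * hardyTwoNorm (fun z => F z ^ (k + 1)) ^ 2 - logPoly p (‖F 0‖ ^ 2)) := by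
    rw [logPoly, ← Finset.sum_sub_distrib, Finset.mul_sum]
    refine Finset.sum_congr rfl fun k _ => ?_
    rw [norm_pow]
    ring
  rw [h1] at hmono
  have h2 : Real.pi / 2 * (∑ k ∈ Finset.range (p + 1),
        logPolyCoeff p k * hardyTwoNorm (fun z => F z ^ (k + 1)) ^ 2 - logPoly p (‖F 0‖ ^ 2)) ≤
      Real.pi / 2 * (K * hardyTwoNorm G ^ 2) := by
    refine hmono.trans ?_
    have : 0 ≤ K * ‖G 0‖ ^ 2 := by positivity
    nlinarith
  exact le_of_mul_le_mul_left h2 hpi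

theorem sum_analyticOrderAt_mul_log_le_of_deriv_le {F G : ℂ → ℂ}
    (hF : AnalyticOnNhd ℂ F (ball 0 1)) (hF1 : ∀ z ∈ ball (0 : ℂ) 1, ‖F z‖ ≤ 1)
    (hF0 : 1 / 2 ≤ ‖F 0‖ ^ 2) (hG : MemHardyTwo G) (p : ℕ) {K : ℝ} (hK : 0 ≤ K)
    (h : ∀ z ∈ ball (0 : ℂ) 1,
      ((p : ℝ) + 1) / 2 * (1 - ‖F z‖ ^ 2) ^ p * ‖deriv F z‖ ^ 2 ≤ K * ‖deriv G z‖ ^ 2)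
    (s : Finset ℂ) (hs : ∀ z ∈ s, ‖z‖ < 1) :
    ∑ z ∈ s, ((analyticOrderAt F z).toNat : ℝ) * Real.log (1 / ‖z‖) ≤
      K * hardyTwoNorm G ^ 2 + (1 - ‖F 0‖ ^ 2) ^ (p + 2) := by
  have hne : F 0 ≠ 0 := by
    intro h0
    rw [h0] at hF0
    norm_num at hF0
  have hH (k : ℕ) := memHardyTwo_pow hF hF1 (k + 1)
  have hlim : Tendsto (fun r : ℝ => ∑ z ∈ s, ((analyticOrderAt F z).toNat : ℝ) *
      Real.log (r / ‖z‖)) (𝓝[<] 1) (𝓝 (∑ z ∈ s, ((analyticOrderAt F z).toNat : ℝ) *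
      Real.log (1 / ‖z‖))) := by
    refine tendsto_finsetSum _ fun z _ => Tendsto.const_mul _ ?_
    -- At `z = 0` both logarithms are `0` by convention.
    rcases eq_or_ne z 0 with rfl | hz0
    · simp
    · have : ContinuousAt (fun r : ℝ => Real.log (r / ‖z‖)) 1 := by
        refine ContinuousAt.log (by fun_prop) ?_
        have := norm_pos_iff.2 hz0
        positivity
      exact this.tendsto.mono_left nhdsWithin_le_nhds
  have hlim2 : Tendsto (fun r : ℝ => ∑ k ∈ Finset.range (p + 1), logPolyCoeff p k *
      sqMean (fun z => F z ^ (k + 1)) r - logPoly p 1 - Real.log ‖F 0‖) (𝓝[<] 1)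
      (𝓝 (∑ k ∈ Finset.range (p + 1), logPolyCoeff p k *
        hardyTwoNorm (fun z => F z ^ (k + 1)) ^ 2 - logPoly p 1 - Real.log ‖F 0‖)) := by
    refine Tendsto.sub_const (Tendsto.sub_const ?_ _) _
    refine tendsto_finsetSum _ fun k _ => Tendsto.const_mul _ ?_
    rw [(hH k).hardyTwoNorm_sq]
    exact (hH k).tendsto_sqMean
  have hle := le_of_tendsto_of_tendsto hlim hlim2 (by
    have hev : ∀ᶠ r in 𝓝[<] (1 : ℝ), ∀ z ∈ s, ‖z‖ ≤ r := by
      rw [Filter.eventually_all_finset]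
      intro z hz
      filter_upwards [Ioo_mem_nhdsLT (hs z hz)] with r hr using hr.1.le
    filter_upwards [hev, Ioo_mem_nhdsLT (show (0 : ℝ) < 1 by norm_num)] with r hr hr01
    have h1 := sum_analyticOrderAt_mul_log_le hr01.1
      (hF.mono (closedBall_subset_ball hr01.2)) hne s hr
    have h2 := circleAverage_log_le hF hne hF1 p hr01.1 hr01.2
    rw [circleAverage_logPoly hF p hr01.1.le hr01.2] at h2
    linarith)
  have h3 := sum_logPolyCoeff_mul_norm_sq_le hF hF1 hG p hK h
  have h4 := logPoly_sub_log_le p hF0 (pow_le_one₀ (norm_nonneg _) (hF1 0 (by simp)))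
  rw [Real.log_pow] at h4
  push_cast at h4
  linarith

/-! ### Szegő kernels and disk automorphisms. -/

/-- The Szegő kernel of the disk with pole parameter `a`. -/
def szegoKernel (a z : ℂ) : ℂ := (1 - conj a * z)⁻¹

theorem norm_conj_mul_lt_one {a z : ℂ} (ha : ‖a‖ < 1) (hz : z ∈ ball (0 : ℂ) 1) :
    ‖conj a * z‖ < 1 := by
  rw [norm_mul, RCLike.norm_conj]
  exact mul_lt_one_of_nonneg_of_lt_one_left (norm_nonneg _) ha (by simpa using (mem_ball_zero_iff.1 hz).le)

theorem one_sub_conj_mul_ne_zero {a z : ℂ} (ha : ‖a‖ < 1) (hz : z ∈ ball (0 : ℂ) 1) :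
    1 - conj a * z ≠ 0 := by
  intro h
  have := norm_conj_mul_lt_one ha hz
  rw [← sub_eq_zero.1 h, norm_one] at this
  exact lt_irrefl _ this

theorem iteratedDeriv_szegoKernel {a : ℂ} (ha : ‖a‖ < 1) (m : ℕ) :
    ∀ z ∈ ball (0 : ℂ) 1, iteratedDeriv m (szegoKernel a) z =
      m.factorial * conj a ^ m * ((1 - conj a * z) ^ (m + 1))⁻¹ := by
  induction m with
  | zero => intro z _; simp [szegoKernel]
  | succ m ih =>
    intro z hz
    rw [iteratedDeriv_succ]
    have heq : iteratedDeriv m (szegoKernel a) =ᶠ[𝓝 z]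
        fun z => m.factorial * conj a ^ m * ((1 - conj a * z) ^ (m + 1))⁻¹ := by
      filter_upwards [isOpen_ball.mem_nhds hz] with u hu using ih u hu
    rw [heq.deriv_eq]
    have hne := one_sub_conj_mul_ne_zero ha hz
    have h1 : HasDerivAt (fun z : ℂ => 1 - conj a * z) (-conj a) z := by
      simpa using ((hasDerivAt_id' z).const_mul (conj a)).const_sub 1
    have h2 := ((h1.fun_pow (m + 1)).fun_inv (pow_ne_zero _ hne)).const_mul
      (m.factorial * conj a ^ m)
    rw [h2.deriv, Nat.factorial_succ]
    push_cast
    field_simp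
    ring

theorem analyticOnNhd_szegoKernel {a : ℂ} (ha : ‖a‖ < 1) :
    AnalyticOnNhd ℂ (szegoKernel a) (ball 0 1) := fun _ hz =>
  (analyticAt_const.sub (analyticAt_const.mul analyticAt_id)).inv (one_sub_conj_mul_ne_zero ha hz)

theorem taylorCoeff_szegoKernel {a : ℂ} (ha : ‖a‖ < 1) (j : ℕ) :
    taylorCoeff (szegoKernel a) j = conj a ^ j := by
  rw [taylorCoeff, iteratedDeriv_szegoKernel ha j 0 (by simp)]
  have : (j.factorial : ℂ) ≠ 0 := by exact_mod_cast j.factorial_ne_zero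
  simp only [mul_zero, sub_zero, one_pow, inv_one, mul_one]
  field_simp

theorem hasSum_szegoKernel {a : ℂ} (ha : ‖a‖ < 1) :
    HasSum (fun j => ‖taylorCoeff (szegoKernel a) j‖ ^ 2) (1 - ‖a‖ ^ 2)⁻¹ := by
  have h := hasSum_geometric_of_lt_one (r := ‖a‖ ^ 2) (by positivity)
    (pow_lt_one₀ (norm_nonneg _) ha two_ne_zero)
  refine h.congr_fun fun j => ?_
  rw [taylorCoeff_szegoKernel ha, norm_pow, RCLike.norm_conj, ← pow_mul, ← pow_mul, mul_comm]

theorem memHardyTwo_szegoKernel {a : ℂ} (ha : ‖a‖ < 1) : MemHardyTwo (szegoKernel a) :=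
  memHardyTwo_iff.2 ⟨analyticOnNhd_szegoKernel ha, (hasSum_szegoKernel ha).summable⟩

theorem hardyTwoNorm_szegoKernel_sq {a : ℂ} (ha : ‖a‖ < 1) :
    hardyTwoNorm (szegoKernel a) ^ 2 = (1 - ‖a‖ ^ 2)⁻¹ := by
  rw [(memHardyTwo_szegoKernel ha).hardyTwoNorm_sq, (hasSum_szegoKernel ha).tsum_eq]

/-- The disk automorphism `z ↦ (z - a) / (1 - conj a z)`. -/
def diskMoebius (a z : ℂ) : ℂ := (z - a) * (1 - conj a * z)⁻¹

theorem one_sub_norm_diskMoebius_sq {a z : ℂ} (ha : ‖a‖ < 1) (hz : z ∈ ball (0 : ℂ) 1) :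
    1 - ‖diskMoebius a z‖ ^ 2 = (1 - ‖a‖ ^ 2) * (1 - ‖z‖ ^ 2) / ‖1 - conj a * z‖ ^ 2 := by
  have hne : ‖1 - conj a * z‖ ≠ 0 := norm_ne_zero_iff.2 (one_sub_conj_mul_ne_zero ha hz)
  rw [diskMoebius, norm_mul, norm_inv, eq_div_iff (pow_ne_zero 2 hne), sub_mul, ← mul_pow,
    inv_mul_cancel_right₀ hne]
  simp only [← Complex.normSq_eq_norm_sq, Complex.normSq_apply]
  simp
  ring

theorem hasDerivAt_diskMoebius {a z : ℂ} (ha : ‖a‖ < 1) (hz : z ∈ ball (0 : ℂ) 1) :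
    HasDerivAt (diskMoebius a) ((1 - ‖a‖ ^ 2 : ℝ) / (1 - conj a * z) ^ 2) z := by
  have hne := one_sub_conj_mul_ne_zero ha hz
  have h1 : HasDerivAt (fun z : ℂ => 1 - conj a * z) (-conj a) z := by
    simpa using ((hasDerivAt_id' z).const_mul (conj a)).const_sub 1
  have h2 := ((hasDerivAt_id' z).sub_const a).fun_mul (h1.fun_inv hne)
  refine h2.congr_deriv ?_
  have h3 : ((‖a‖ ^ 2 : ℝ) : ℂ) = a * conj a := by
    rw [Complex.mul_conj, Complex.normSq_eq_norm_sq]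
  rw [Complex.ofReal_sub, h3]
  field_simp
  push_cast
  ring

theorem norm_diskMoebius_le_one {a z : ℂ} (ha : ‖a‖ < 1) (hz : z ∈ ball (0 : ℂ) 1) :
    ‖diskMoebius a z‖ ≤ 1 := by
  have h := one_sub_norm_diskMoebius_sq ha hz
  have hz1 : ‖z‖ < 1 := by simpa using hz
  have h1 : 0 ≤ 1 - ‖a‖ ^ 2 := by nlinarith [norm_nonneg a]
  have h2 : 0 ≤ 1 - ‖z‖ ^ 2 := by nlinarith [norm_nonneg z]
  have : 0 ≤ 1 - ‖diskMoebius a z‖ ^ 2 := by rw [h]; positivity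
  nlinarith [norm_nonneg (diskMoebius a z)]

theorem one_sub_norm_le_norm {a : ℂ} (ha : ‖a‖ < 1) (z : ℂ) : 1 - ‖z‖ ≤ ‖1 - conj a * z‖ := by
  have h1 : ‖(1 : ℂ)‖ - ‖conj a * z‖ ≤ ‖1 - conj a * z‖ := norm_sub_norm_le _ _
  rw [norm_one, norm_mul, RCLike.norm_conj] at h1
  nlinarith [norm_nonneg z]

/-- With `d = |1 - conj a z|` and `A = 1 - |a|²`, one has `1 - |ψ|² ≤ 2A/d` and `|ψ'| = A/d²` for
the automorphism `ψ`, so the left side is `O(A^(2n+2)/d^(2n+4))`. The kernel derivative squared has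
the same power of `d`; `‖a‖ ≥ 1/2` keeps its numerator away from `0`. -/
theorem diskMoebius_kernel_bound {a z : ℂ} (ha : ‖a‖ < 1) (ha2 : 1 / 2 ≤ ‖a‖)
    (hz : z ∈ ball (0 : ℂ) 1) (n : ℕ) :
    (((2 * n : ℕ) : ℝ) + 1) / 2 * (1 - ‖diskMoebius a z‖ ^ 2) ^ (2 * n) *
        ‖deriv (diskMoebius a) z‖ ^ 2 ≤
      ((2 * n + 1) * 16 ^ (n + 1) * (1 - ‖a‖ ^ 2) ^ (2 * n + 2)) *
        ‖iteratedDeriv (n + 1) (szegoKernel a) z‖ ^ 2 := by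
  have hz1 : ‖z‖ < 1 := by simpa using hz
  have hA : 0 ≤ 1 - ‖a‖ ^ 2 := by nlinarith [norm_nonneg a]
  have hd : 0 < ‖1 - conj a * z‖ := norm_pos_iff.2 (one_sub_conj_mul_ne_zero ha hz)
  set d := ‖1 - conj a * z‖ with hd_def
  set A := 1 - ‖a‖ ^ 2 with hA_def
  have hB : 0 ≤ 1 - ‖z‖ ^ 2 := by nlinarith [norm_nonneg z]
  have hBd : 1 - ‖z‖ ^ 2 ≤ 2 * d := by
    have := one_sub_norm_le_norm ha z
    nlinarith [norm_nonneg z]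
  have hderiv : ‖deriv (diskMoebius a) z‖ ^ 2 = A ^ 2 / d ^ 4 := by
    rw [(hasDerivAt_diskMoebius ha hz).deriv, norm_div, norm_pow, Complex.norm_real,
      Real.norm_of_nonneg hA, div_pow, ← pow_mul]
  have hiter : (1 / 4 : ℝ) ^ (n + 1) / d ^ (2 * n + 4) ≤
      ‖iteratedDeriv (n + 1) (szegoKernel a) z‖ ^ 2 := by
    rw [iteratedDeriv_szegoKernel ha _ z hz, norm_mul, norm_mul, norm_inv, norm_pow, norm_pow,
      RCLike.norm_conj, Complex.norm_natCast, mul_pow, mul_pow, inv_pow, ← pow_mul, ← pow_mul,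
      div_eq_mul_inv]
    have h1 : (1 : ℝ) ≤ ((n + 1).factorial : ℝ) ^ 2 :=
      one_le_pow₀ (by exact_mod_cast (n + 1).factorial_pos)
    have h2 : (1 / 4 : ℝ) ^ (n + 1) ≤ ‖a‖ ^ ((n + 1) * 2) := by
      rw [mul_comm, pow_mul]
      gcongr
      nlinarith
    have h3 : (n + 1 + 1) * 2 = 2 * n + 4 := by ring
    rw [h3]
    gcongr
    calc (1 / 4 : ℝ) ^ (n + 1) ≤ ‖a‖ ^ ((n + 1) * 2) := h2
      _ ≤ _ := le_mul_of_one_le_left (by positivity) h1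
  rw [one_sub_norm_diskMoebius_sq ha hz, hderiv]
  calc (((2 * n : ℕ) : ℝ) + 1) / 2 * (A * (1 - ‖z‖ ^ 2) / d ^ 2) ^ (2 * n) * (A ^ 2 / d ^ 4)
      ≤ (((2 * n : ℕ) : ℝ) + 1) / 2 * (A * (2 * d) / d ^ 2) ^ (2 * n) * (A ^ 2 / d ^ 4) := by
        gcongr
    _ = (2 * n + 1) / 2 * 4 ^ n * A ^ (2 * n + 2) / d ^ (2 * n + 4) := by
        have h1 : A * (2 * d) / d ^ 2 = 2 * A / d := by field_simp
        rw [h1, div_pow, mul_pow, pow_mul 2 2 n]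
        push_cast
        rw [pow_add A, pow_add d]
        field_simp
        ring
    _ ≤ (2 * n + 1) * 4 ^ (n + 1) * A ^ (2 * n + 2) / d ^ (2 * n + 4) := by
        have h1 : (2 * (n : ℝ) + 1) / 2 ≤ 2 * n + 1 := by
          have : (0 : ℝ) ≤ n := by positivity
          linarith
        gcongr
        · norm_num
        · omega
    _ = ((2 * n + 1) * 16 ^ (n + 1) * A ^ (2 * n + 2)) *
        ((1 / 4 : ℝ) ^ (n + 1) / d ^ (2 * n + 4)) := by
        have h1 : (16 : ℝ) ^ (n + 1) * (1 / 4) ^ (n + 1) = 4 ^ (n + 1) := by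
          rw [← mul_pow]; norm_num
        rw [← h1]
        ring
    _ ≤ _ := by gcongr

/-! ### Necessity of the counting condition. -/

/-- A bound for all finite sums of zeros of `φ - w` bounds the counting function. -/
theorem nevanlinnaCounting_le {φ : ℂ → ℂ} (hφ : AnalyticOnNhd ℂ φ (ball 0 1)) {w : ℂ}
    (hw : w ≠ φ 0) {X : ℝ}
    (h : ∀ s : Finset ℂ, (∀ z ∈ s, ‖z‖ < 1) →
      ∑ z ∈ s, ((analyticOrderAt (fun u => φ u - w) z).toNat : ℝ) * Real.log (1 / ‖z‖) ≤ X) :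
    nevanlinnaCounting φ w ≤ ENNReal.ofReal X := by
  classical
  rw [nevanlinnaCounting, if_neg hw, ENNReal.tsum_eq_iSup_sum]
  refine iSup_le fun s => ?_
  have han : AnalyticOnNhd ℂ (fun u => φ u - w) (ball 0 1) := hφ.sub analyticOnNhd_const
  -- Nonvanishing at `0` and the identity theorem make all orders finite, so `toNat` loses nothing.
  have hne (z : ℂ) (hz : z ∈ ball (0 : ℂ) 1) : analyticOrderAt (fun u => φ u - w) z ≠ ⊤ := by
    refine han.analyticOrderAt_ne_top_of_isPreconnected (convex_ball _ _).isPreconnected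
      (x := 0) (by simp) hz ?_
    have h0 : analyticOrderAt (fun u => φ u - w) 0 = 0 :=
      (han 0 (by simp)).analyticOrderAt_eq_zero.2 (sub_ne_zero.2 hw.symm)
    simp [h0]
  have hterm (z : {z : ℂ // z ∈ ball (0 : ℂ) 1 ∧ φ z = w}) :
      ((analyticOrderAt (fun u => φ u - w) (z : ℂ) : ℕ∞) : ℝ≥0∞) *
        ENNReal.ofReal (Real.log (1 / ‖(z : ℂ)‖)) =
      ENNReal.ofReal (((analyticOrderAt (fun u => φ u - w) (z : ℂ)).toNat : ℝ) *
        Real.log (1 / ‖(z : ℂ)‖)) := by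
    rw [ENNReal.ofReal_mul (by positivity), ENNReal.ofReal_natCast]
    congr 1
    conv_lhs => rw [← ENat.natCast_toNat (hne z z.2.1)]
    simp
  have hnn (z : {z : ℂ // z ∈ ball (0 : ℂ) 1 ∧ φ z = w}) :
      0 ≤ ((analyticOrderAt (fun u => φ u - w) (z : ℂ)).toNat : ℝ) *
        Real.log (1 / ‖(z : ℂ)‖) := by
    refine mul_nonneg (by positivity) ?_
    rcases eq_or_ne (z : ℂ) 0 with hz0 | hz0
    · simp [hz0]
    · exact Real.log_nonneg ((one_le_div (norm_pos_iff.2 hz0)).2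
        (mem_ball_zero_iff.1 z.2.1).le)
  simp only [hterm]
  rw [← ENNReal.ofReal_sum_of_nonneg fun z _ => hnn z]
  refine ENNReal.ofReal_le_ofReal ?_
  have := h (s.map (Function.Embedding.subtype _)) (by
    intro z hz
    obtain ⟨y, -, rfl⟩ := Finset.mem_map.1 hz
    exact mem_ball_zero_iff.1 y.2.1)
  simpa using this

theorem countingBigO_of_isBoundedOnHardyTwo {φ : ℂ → ℂ} (hφ : IsAnalyticSelfMap φ) (n : ℕ)
    (h : IsBoundedOnHardyTwo (compDiff φ n)) : CountingBigO φ (2 * n + 1) := by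
  obtain ⟨hmem, C, hC⟩ := h
  have h0 : (0 : ℂ) ∈ ball (0 : ℂ) 1 := by simp
  have hφ0 : ‖φ 0‖ < 1 := by simpa using hφ.2 h0
  set B : ℝ := ((1 - ‖φ 0‖) ^ 2)⁻¹ with hB
  have hB1 : 1 ≤ B := by
    rw [hB]
    refine (one_le_inv₀ (by have := sub_pos.2 hφ0; positivity)).2 ?_
    exact pow_le_one₀ (sub_pos.2 hφ0).le (by linarith [norm_nonneg (φ 0)])
  set X : ℝ := (2 * n + 1) * 16 ^ (n + 1) * C ^ 2 + B ^ (2 * n + 2) with hX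
  have hX0 : 0 ≤ X := by positivity
  -- The radius ensures `|w| > 1/2` for the kernel bound and `A * B ≤ 1/2`, hence `|F(0)|² ≥ 1/2`.
  -- The power of `2` comes from `A ≤ 2 (1 - |w|) ≤ 2 log(1/|w|)`.
  refine countingBigO_iff.2 ⟨(X * 2 ^ (2 * n + 1)).toNNReal, max (1 / 2) (1 - 1 / (4 * B)),
    by positivity, max_lt (by norm_num) (by
      have : 0 < 1 / (4 * B) := by positivity
      linarith), fun w hw hw1 => ?_⟩
  have hw2 : 1 / 2 < ‖w‖ := (le_max_left _ _).trans_lt hw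
  have hwB : 1 - 1 / (4 * B) < ‖w‖ := (le_max_right _ _).trans_lt hw
  set A := 1 - ‖w‖ ^ 2 with hA
  have hA0 : 0 < A := by nlinarith [norm_nonneg w]
  have hA1 : A ≤ 1 := by nlinarith [norm_nonneg w]
  have hA2 : A ≤ 2 * (1 - ‖w‖) := by nlinarith [norm_nonneg w]
  have hAB : A * B ≤ 1 / 2 := by
    have h1 : A ≤ 1 / (2 * B) := by
      refine hA2.trans ?_
      have : 1 / (2 * B) = 2 * (1 / (4 * B)) := by field_simp; norm_num
      rw [this]
      linarith
    calc A * B ≤ 1 / (2 * B) * B := by gcongr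
      _ = 1 / 2 := by field_simp
  set F : ℂ → ℂ := fun z => diskMoebius w (φ z) with hF_def
  have hanu : AnalyticOnNhd ℂ (fun z => (1 - conj w * φ z)⁻¹) (ball 0 1) := fun z hz =>
    (analyticAt_const.sub (analyticAt_const.mul (hφ.1 z hz))).inv
      (one_sub_conj_mul_ne_zero hw1 (hφ.2 hz))
  have hanw : AnalyticOnNhd ℂ (fun z => φ z - w) (ball 0 1) := hφ.1.sub analyticOnNhd_const
  have hF : AnalyticOnNhd ℂ F (ball 0 1) := hanw.mul hanu
  have hF1 : ∀ z ∈ ball (0 : ℂ) 1, ‖F z‖ ≤ 1 := fun z hz => norm_diskMoebius_le_one hw1 (hφ.2 hz)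
  have hF0 : 1 - ‖F 0‖ ^ 2 ≤ A * B := by
    rw [hF_def, one_sub_norm_diskMoebius_sq hw1 (hφ.2 h0), div_eq_mul_inv, hB, mul_assoc]
    have h1 := one_sub_norm_le_norm hw1 (φ 0)
    have h2 : 0 < 1 - ‖φ 0‖ := sub_pos.2 hφ0
    refine mul_le_mul_of_nonneg_left ?_ hA0.le
    calc (1 - ‖φ 0‖ ^ 2) * (‖1 - conj w * φ 0‖ ^ 2)⁻¹ ≤ 1 * ((1 - ‖φ 0‖) ^ 2)⁻¹ := by
          gcongr
          nlinarith [norm_nonneg (φ 0)]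
      _ = _ := one_mul _
  have hFnn : 0 ≤ 1 - ‖F 0‖ ^ 2 := by
    nlinarith [hF1 0 h0, norm_nonneg (F 0)]
  -- Otherwise `F` would vanish at `0`; this avoids the point where the counting function is
  -- infinite.
  have hwφ : w ≠ φ 0 := by
    intro heq
    have : F 0 = 0 := by simp [hF_def, diskMoebius, ← heq]
    rw [this] at hF0
    norm_num at hF0
    linarith
  set K : ℝ := (2 * n + 1) * 16 ^ (n + 1) * A ^ (2 * n + 2) with hK
  have hk := memHardyTwo_szegoKernel hw1
  have hG := hmem _ hk
  have hderiv : ∀ z ∈ ball (0 : ℂ) 1,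
      (((2 * n : ℕ) : ℝ) + 1) / 2 * (1 - ‖F z‖ ^ 2) ^ (2 * n) * ‖deriv F z‖ ^ 2 ≤
        K * ‖deriv (compDiff φ n (szegoKernel w)) z‖ ^ 2 := by
    intro z hz
    have h1 : deriv F z = deriv (diskMoebius w) (φ z) * deriv φ z :=
      ((hasDerivAt_diskMoebius hw1 (hφ.2 hz)).differentiableAt.hasDerivAt.comp z
        (hφ.1 z hz).differentiableAt.hasDerivAt).deriv
    rw [h1, deriv_compDiff hφ n hk.1 hz, norm_mul, norm_mul, mul_pow, mul_pow, ← mul_assoc,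
      ← mul_assoc]
    exact mul_le_mul_of_nonneg_right (diskMoebius_kernel_bound hw1 hw2.le (hφ.2 hz) n)
      (by positivity)
  -- The denominator of the automorphism never vanishes, so multiplicities are unchanged.
  have horder (z : ℂ) (hz : ‖z‖ < 1) :
      analyticOrderAt F z = analyticOrderAt (fun u => φ u - w) z := by
    have hz' : z ∈ ball (0 : ℂ) 1 := by simpa using hz
    have h1 : analyticOrderAt (fun z => (1 - conj w * φ z)⁻¹) z = 0 :=
      (hanu z hz').analyticOrderAt_eq_zero.2
        (inv_ne_zero (one_sub_conj_mul_ne_zero hw1 (hφ.2 hz')))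
    have h2 := analyticOrderAt_mul (hanw z hz') (hanu z hz')
    rw [h1, add_zero] at h2
    exact h2
  have hbound : nevanlinnaCounting φ w ≤ ENNReal.ofReal (X * A ^ (2 * n + 1)) := by
    refine nevanlinnaCounting_le hφ.1 hwφ fun s hs => ?_
    have h1 := sum_analyticOrderAt_mul_log_le_of_deriv_le hF hF1 (by linarith) hG (2 * n)
      (by positivity) hderiv s hs
    rw [Finset.sum_congr rfl fun z hz => by rw [horder z (hs z hz)]] at h1
    refine h1.trans ?_
    rw [hX, add_mul]
    refine add_le_add ?_ ?_
    · have h2 : hardyTwoNorm (compDiff φ n (szegoKernel w)) ^ 2 ≤ C ^ 2 * A⁻¹ := by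
        rw [hA, ← hardyTwoNorm_szegoKernel_sq hw1, ← mul_pow]
        exact pow_le_pow_left₀ (hardyTwoNorm_nonneg _) (hC _ hk) 2
      calc K * hardyTwoNorm (compDiff φ n (szegoKernel w)) ^ 2 ≤ K * (C ^ 2 * A⁻¹) := by
            gcongr
        _ = _ := by
            rw [hK, pow_succ A (2 * n + 1)]
            field_simp
    · calc (1 - ‖F 0‖ ^ 2) ^ (2 * n + 2) ≤ (A * B) ^ (2 * n + 2) := by gcongr
        _ = B ^ (2 * n + 2) * A ^ (2 * n + 1) * A := by ring_nf
        _ ≤ B ^ (2 * n + 2) * A ^ (2 * n + 1) := mul_le_of_le_one_right (by positivity) hA1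
  refine hbound.trans ?_
  rw [← ENNReal.ofReal_coe_nnreal, Real.coe_toNNReal _ (by positivity),
    ← ENNReal.ofReal_mul (by positivity), mul_assoc, ← mul_pow]
  refine ENNReal.ofReal_le_ofReal ?_
  have hlog : 1 - ‖w‖ ≤ Real.log (1 / ‖w‖) := by
    rw [one_div, Real.log_inv]
    linarith [Real.log_le_sub_one_of_pos (show 0 < ‖w‖ by linarith)]
  gcongr
  linarith

end

theorem theorem2p1 (φ : ℂ → ℂ) (hφ : IsAnalyticSelfMap φ) (n : ℕ) (hn : 0 < n) :
    IsBoundedOnHardyTwo (compDiff φ n) ↔ CountingBigO φ (2 * n + 1) :=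
  ⟨countingBigO_of_isBoundedOnHardyTwo hφ n, isBoundedOnHardyTwo_of_countingBigO hφ n⟩
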